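/- Let \(s,t\ge 1\) and let \(\mathrm{Spin}(s,t)\) be the group of products of an even number of vectors \(v\) with \(v^2=\pm1\) in the Clifford algebra of \(\mathbb{R}^{s,t}\), with its double covering \(\pi:\mathrm{Spin}(s,t)\to \mathrm{SO}(s,t)\), \(\pi(a)v=ava^{-1}\). Let \(G\) be a Lie group with a chosen central element \(-1\in G\) of order two, put \(\mathrm{Spin}^G(s,t)=(\mathrm{Spin}(s,t)\times G)/\{(1,1),(-1,-1)\}\), and write \([a,g]\) for the class of \((a,g)\). Let \(\widehat\pi:\mathrm{Spin}^G(s,t)\to\mathrm{SO}(s,t)\) be \(\widehat\pi([a,g])=\pi(a)\). Let \(\mathrm{SO}_0(s,t)\) and \(\mathrm{Spin}_0(s,t)\) be the identity components of \(\mathrm{SO}(s,t)\) and \(\mathrm{Spin}(s,t)\), and let \[\mathrm{Spin}^G_0(s,t)=\mathrm{Spin}_0(s,t)\times_{\mathbb{Z}_2}G:=\{[a,g] : a\in\mathrm{Spin}_0(s,t),\ g\in G\}\subset \mathrm{Spin}^G(s,t).\] Let \((M,g)\) be an oriented smooth pseudo-Riemannian manifold of signature \((s,t)\), with special orthonormal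 frame bundle \(F_{SO}\to M\) (a principal \(\mathrm{SO}(s,t)\)-bundle), equipped with a spin-\(G\) structure: a smooth principal \(\mathrm{Spin}^G(s,t)\)-bundle \(\widehat P\to M\) together with a smooth bundle map \(\widehat\varpi:\widehat P\to F_{SO}\) over \(M\) such that \(\widehat\varpi(p\cdot k)=\widehat\varpi(p)\cdot\widehat\pi(k)\) for all \(p\in\widehat P\) and \(k\in\mathrm{Spin}^G(s,t)\). A reduction of the structure group of a principal bundle to a subgroup \(H\) is a smooth principal \(H\)-subbundle, and \((M,g)\) is called time-orientable if the structure group of \(F_{SO}\to M\) reduces to \(\mathrm{SO}_0(s,t)\). Then \((M,g)\) is time-orientable if and only if the structure group of \(\widehat P\to M\) reduces to the subgroup \(\mathrm{Spin}^G_0(s,t)\). -/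

import Mathlib

open scoped Manifold ContDiff Topology Matrix

noncomputable section

/-! ## The groups `SO(s,t)` and `Spin(s,t)` -/

/-- Index set of the standard basis of `ℝ^{s,t}`: `s` positive and `t` negative directions. -/
abbrev Idx (s t : ℕ) : Type := Fin s ⊕ Fin t

/-- The quadratic form of `ℝ^{s,t}`: `x₁² + ⋯ + x_s² - y₁² - ⋯ - y_t²`. -/
def stdForm (s t : ℕ) : QuadraticForm ℝ (Idx s t → ℝ) :=
  QuadraticMap.weightedSumSquares ℝ (Sum.elim (fun _ => (1 : ℝ)) (fun _ => (-1 : ℝ)))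

/-- `SO(s,t)`: the matrices of determinant one that preserve the quadratic form of `ℝ^{s,t}`,
with the topology and group structure inherited from `SL`. -/
def SO (s t : ℕ) : Subgroup (Matrix.SpecialLinearGroup (Idx s t) ℝ) where
  carrier := {A | ∀ v, stdForm s t (Matrix.SpecialLinearGroup.toLin' A v) = stdForm s t v}
  one_mem' := by intro v; simp
  mul_mem' := by
    intro A B hA hB v
    rw [map_mul]
    exact (hA _).trans (hB v)
  inv_mem' := by
    intro A hA v
    have h := hA (Matrix.SpecialLinearGroup.toLin' A⁻¹ v)
    rw [← h]
    congr 1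
    rw [← LinearEquiv.mul_apply, ← map_mul, mul_inv_cancel, map_one]
    rfl

/-- `SO₀(s,t)`: the connected component of the identity of `SO(s,t)`. -/
def SO₀ (s t : ℕ) : Subgroup (SO s t) := Subgroup.connectedComponentOfOne (SO s t)

/-- The real Clifford algebra of `ℝ^{s,t}`. -/
abbrev Cl (s t : ℕ) : Type := CliffordAlgebra (stdForm s t)

/-- `v` is a unit vector of `ℝ^{s,t}`: its square is `1` or `-1`. -/
def IsUnitVector (s t : ℕ) (v : Idx s t → ℝ) : Prop := stdForm s t v = 1 ∨ stdForm s t v = -1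

/-- `Spin(s,t)`: the group of the products of an even number of unit vectors (of either sign)
in the Clifford algebra; the double cover of the whole of `SO(s,t)`. The generator `-1` is
redundant unless `s = t = 0`. (Mathlib's `spinGroup` only has the elements of spinor norm `1`, so
for indefinite forms it is smaller: it does not map onto `SO(s,t)`.) -/
def Spin (s t : ℕ) : Subgroup (Cl s t)ˣ :=
  Subgroup.closure ({-1} ∪ {u | ∃ v w, IsUnitVector s t v ∧ IsUnitVector s t w ∧
    (u : Cl s t) = CliffordAlgebra.ι (stdForm s t) v * CliffordAlgebra.ι (stdForm s t) w})

/-- The element `-1` of `Spin(s,t)`. -/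
def Spin.negOne (s t : ℕ) : Spin s t := ⟨-1, Subgroup.subset_closure (Or.inl rfl)⟩

/-- `Spin(s,t)` has the subspace topology of the Clifford algebra (a finite-dimensional
real vector space with its standard topology). -/
instance Spin.topologicalSpace (s t : ℕ) : TopologicalSpace (Spin s t) :=
  TopologicalSpace.induced (fun a => ((a : (Cl s t)ˣ) : Cl s t)) (moduleTopology ℝ (Cl s t))

theorem Spin.continuous_mul_left {s t : ℕ} (a : Spin s t) :
    Continuous (fun b : Spin s t => a * b) := by
  let : TopologicalSpace (Cl s t) := moduleTopology ℝ (Cl s t)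
  have : IsModuleTopology ℝ (Cl s t) := ⟨rfl⟩
  have : ContinuousAdd (Cl s t) := IsModuleTopology.toContinuousAdd ℝ (Cl s t)
  have : ContinuousSMul ℝ (Cl s t) := IsModuleTopology.toContinuousSMul ℝ (Cl s t)
  rw [continuous_induced_rng]
  have h : Continuous (LinearMap.mulLeft ℝ ((a : (Cl s t)ˣ) : Cl s t)) :=
    IsModuleTopology.continuous_of_linearMap _
  exact h.comp continuous_induced_dom

/-- `Spin₀(s,t)`: the connected component of the identity of `Spin(s,t)`. -/
def Spin₀ (s t : ℕ) : Subgroup (Spin s t) where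
  carrier := connectedComponent 1
  one_mem' := mem_connectedComponent
  mul_mem' := by
    intro a b ha hb
    have h := (Spin.continuous_mul_left a).image_connectedComponent_subset 1
    have h2 := h ⟨b, hb, rfl⟩
    rw [mul_one] at h2
    rwa [connectedComponent_eq ha]
  inv_mem' := by
    intro a ha
    have h := (Spin.continuous_mul_left a⁻¹).image_connectedComponent_subset a
    rw [← connectedComponent_eq ha] at h
    have h2 := h ⟨1, mem_connectedComponent, rfl⟩
    simpa using h2

/-- A linear left inverse of the inclusion of `ℝ^{s,t}` into its Clifford algebra. -/
def Cl.toVector (s t : ℕ) : Cl s t →ₗ[ℝ] (Idx s t → ℝ) :=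
  ExteriorAlgebra.ιInv ∘ₗ (CliffordAlgebra.equivExterior (stdForm s t)).toLinearMap

theorem Cl.toVector_ι {s t : ℕ} (v : Idx s t → ℝ) :
    Cl.toVector s t (CliffordAlgebra.ι (stdForm s t) v) = v := by
  have h : CliffordAlgebra.equivExterior (stdForm s t) (CliffordAlgebra.ι (stdForm s t) v)
      = ExteriorAlgebra.ι ℝ v := by
    simp [CliffordAlgebra.equivExterior, CliffordAlgebra.changeFormEquiv_apply,
      CliffordAlgebra.changeForm_ι, ExteriorAlgebra.ι]
  simp only [Cl.toVector, LinearMap.comp_apply, LinearEquiv.coe_coe]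
  rw [h]
  exact ExteriorAlgebra.ι_leftInverse v

theorem Cl.conj_unit {s t : ℕ} {v : Idx s t → ℝ} (hv : IsUnitVector s t v) :
    ∃ A : (Idx s t → ℝ) →ₗ[ℝ] (Idx s t → ℝ),
      LinearMap.det A = -(-1) ^ Fintype.card (Idx s t) ∧ ∀ x,
      CliffordAlgebra.ι (stdForm s t) v * CliffordAlgebra.ι (stdForm s t) x
        = CliffordAlgebra.ι (stdForm s t) (A x) * CliffordAlgebra.ι (stdForm s t) v := by
  have hq : stdForm s t v * stdForm s t v = 1 := by rcases hv with h | h <;> rw [h] <;> norm_num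
  have hvv : stdForm s t v ≠ 0 := by rintro h; rw [h] at hq; norm_num at hq
  let f : Module.Dual ℝ (Idx s t → ℝ) :=
    (-(stdForm s t v)) • (QuadraticMap.polarBilin (stdForm s t) v)
  have hf : ∀ x, f x = -(stdForm s t v) * QuadraticMap.polar (stdForm s t) v x := fun x => rfl
  have hfv : f v = -2 := by
    rw [hf, QuadraticMap.polar_self, two_nsmul]
    linear_combination (-2) * hq
  refine ⟨(-1 : ℝ) • LinearMap.transvection f v, ?_, fun x => ?_⟩
  · rw [LinearMap.det_smul, LinearMap.transvection.det, hfv]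
    simp
    ring
  · have h1 := CliffordAlgebra.ι_mul_ι_add_swap (Q := stdForm s t) v x
    have h2 := CliffordAlgebra.ι_sq_scalar (stdForm s t) v
    have hA : ((-1 : ℝ) • LinearMap.transvection f v) x
        = (stdForm s t v * QuadraticMap.polar (stdForm s t) v x) • v - x := by
      rw [LinearMap.smul_apply, LinearMap.transvection.apply, hf]
      module
    rw [hA, map_sub, map_smul, sub_mul, smul_mul_assoc, h2, eq_sub_iff_add_eq, h1,
      Algebra.algebraMap_eq_smul_one, Algebra.algebraMap_eq_smul_one, smul_smul]
    congr 1
    linear_combination (-QuadraticMap.polar (stdForm s t) v x) * hq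

/-- Conjugation by an element of the spin group acts on vectors with determinant one. -/
theorem Spin.exists_conj {s t : ℕ} (a : Spin s t) :
    ∃ A : (Idx s t → ℝ) →ₗ[ℝ] (Idx s t → ℝ), LinearMap.det A = 1 ∧ ∀ x,
      ((a : (Cl s t)ˣ) : Cl s t) * CliffordAlgebra.ι (stdForm s t) x
        = CliffordAlgebra.ι (stdForm s t) (A x) * ((a : (Cl s t)ˣ) : Cl s t) := by
  obtain ⟨u, hu⟩ := a
  simp only
  unfold Spin at hu
  induction hu using Subgroup.closure_induction with
  | mem u hu =>
    rcases hu with hu | ⟨v, w, hv, hw, hu⟩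
    · refine ⟨LinearMap.id, by simp, fun x => ?_⟩
      rw [Set.mem_singleton_iff] at hu
      simp [hu]
    · obtain ⟨A, hA, hA'⟩ := Cl.conj_unit hv
      obtain ⟨B, hB, hB'⟩ := Cl.conj_unit hw
      refine ⟨A ∘ₗ B, ?_, fun x => ?_⟩
      · rw [LinearMap.det_comp, hA, hB, neg_mul_neg, ← mul_pow]
        norm_num
      · rw [hu, mul_assoc, hB', ← mul_assoc, hA', mul_assoc]
        rfl
  | one => exact ⟨LinearMap.id, by simp, by simp⟩
  | mul u w _ _ hu hw =>
    obtain ⟨A, hA, hA'⟩ := hu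
    obtain ⟨B, hB, hB'⟩ := hw
    refine ⟨A ∘ₗ B, by rw [LinearMap.det_comp, hA, hB, one_mul], fun x => ?_⟩
    rw [Units.val_mul, mul_assoc, hB', ← mul_assoc, hA', mul_assoc]
    rfl
  | inv u _ hu =>
    obtain ⟨A, hA, hA'⟩ := hu
    let e := LinearMap.equivOfDetNeZero A (by rw [hA]; exact one_ne_zero)
    have he : ∀ x, A (e.symm x) = x := fun x => e.apply_symm_apply x
    refine ⟨e.symm, ?_, fun x => ?_⟩
    · have h := LinearMap.det_comp A (e.symm : (Idx s t → ℝ) →ₗ[ℝ] (Idx s t → ℝ))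
      have h2 : A ∘ₗ (e.symm : (Idx s t → ℝ) →ₗ[ℝ] (Idx s t → ℝ)) = LinearMap.id :=
        LinearMap.ext he
      rw [h2, hA, one_mul, LinearMap.det_id] at h
      exact h.symm
    · have h := hA' (e.symm x)
      rw [he] at h
      rw [Units.inv_mul_eq_iff_eq_mul, ← mul_assoc, LinearEquiv.coe_coe, h, mul_assoc,
        Units.mul_inv, mul_one]

/-- The action `v ↦ a v a⁻¹` of the spin group on vectors. -/
def Spin.conj {s t : ℕ} (a : Spin s t) : (Idx s t → ℝ) →ₗ[ℝ] (Idx s t → ℝ) :=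
  Cl.toVector s t ∘ₗ LinearMap.mulRight ℝ ((a⁻¹ : Spin s t) : (Cl s t)ˣ).val ∘ₗ
    LinearMap.mulLeft ℝ ((a : (Cl s t)ˣ) : Cl s t) ∘ₗ CliffordAlgebra.ι (stdForm s t)

theorem Spin.conj_eq {s t : ℕ} {a : Spin s t} {A : (Idx s t → ℝ) →ₗ[ℝ] (Idx s t → ℝ)}
    (hA : ∀ x, ((a : (Cl s t)ˣ) : Cl s t) * CliffordAlgebra.ι (stdForm s t) x
        = CliffordAlgebra.ι (stdForm s t) (A x) * ((a : (Cl s t)ˣ) : Cl s t)) :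
    Spin.conj a = A := by
  refine LinearMap.ext fun x => ?_
  have h : Spin.conj a x = Cl.toVector s t (((a : (Cl s t)ˣ) : Cl s t) *
    CliffordAlgebra.ι (stdForm s t) x * ((a⁻¹ : Spin s t) : (Cl s t)ˣ).val) := rfl
  rw [h, hA, mul_assoc, InvMemClass.coe_inv, Units.mul_inv, mul_one, Cl.toVector_ι]

theorem Spin.mul_ι {s t : ℕ} (a : Spin s t) (x : Idx s t → ℝ) :
    ((a : (Cl s t)ˣ) : Cl s t) * CliffordAlgebra.ι (stdForm s t) x
      = CliffordAlgebra.ι (stdForm s t) (Spin.conj a x) * ((a : (Cl s t)ˣ) : Cl s t) := by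
  obtain ⟨A, _, hA⟩ := Spin.exists_conj a
  rw [Spin.conj_eq hA, hA]

theorem Spin.det_conj {s t : ℕ} (a : Spin s t) : LinearMap.det (Spin.conj a) = 1 := by
  obtain ⟨A, h, hA⟩ := Spin.exists_conj a
  rw [Spin.conj_eq hA, h]

theorem Spin.conj_mul {s t : ℕ} (a b : Spin s t) :
    Spin.conj (a * b) = Spin.conj a ∘ₗ Spin.conj b := by
  refine Spin.conj_eq fun x => ?_
  rw [Subgroup.coe_mul, Units.val_mul, mul_assoc, Spin.mul_ι, ← mul_assoc, Spin.mul_ι, mul_assoc]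
  rfl

theorem Spin.conj_one {s t : ℕ} : Spin.conj (1 : Spin s t) = LinearMap.id :=
  Spin.conj_eq fun x => by simp

theorem Spin.conj_negOne {s t : ℕ} : Spin.conj (Spin.negOne s t) = LinearMap.id :=
  Spin.conj_eq fun x => by simp [Spin.negOne]

theorem Spin.stdForm_conj {s t : ℕ} (a : Spin s t) (x : Idx s t → ℝ) :
    stdForm s t (Spin.conj a x) = stdForm s t x := by
  have h1 := CliffordAlgebra.ι_sq_scalar (stdForm s t) (Spin.conj a x)
  have h2 := CliffordAlgebra.ι_sq_scalar (stdForm s t) x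
  have h := Spin.mul_ι a x
  have h3 : algebraMap ℝ (Cl s t) (stdForm s t (Spin.conj a x)) * ((a : (Cl s t)ˣ) : Cl s t)
      = algebraMap ℝ (Cl s t) (stdForm s t x) * ((a : (Cl s t)ˣ) : Cl s t) := by
    rw [← h1, mul_assoc, ← h, ← mul_assoc, ← h, mul_assoc, h2, Algebra.commutes]
  exact (algebraMap ℝ (Cl s t)).injective ((Units.mul_left_inj _).1 h3)

/-- The matrix of `v ↦ a v a⁻¹`. -/
def Spin.toSL {s t : ℕ} (a : Spin s t) : Matrix.SpecialLinearGroup (Idx s t) ℝ :=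
  ⟨LinearMap.toMatrix' (Spin.conj a), by rw [LinearMap.det_toMatrix', Spin.det_conj]⟩

theorem Spin.coe_toSL {s t : ℕ} (a : Spin s t) :
    (Spin.toSL a : Matrix (Idx s t) (Idx s t) ℝ) = LinearMap.toMatrix' (Spin.conj a) := rfl

/-- The canonical double covering `π : Spin(s,t) → SO(s,t)`, `π(a) v = a v a⁻¹`. -/
def Spin.π (s t : ℕ) : Spin s t →* SO s t where
  toFun a := ⟨Spin.toSL a, fun v => by
      rw [Matrix.SpecialLinearGroup.toLin'_apply, Spin.coe_toSL, Matrix.toLin'_toMatrix',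
        Spin.stdForm_conj]⟩
  map_one' := by
    apply Subtype.ext
    apply Subtype.ext
    simp [Spin.coe_toSL, Spin.conj_one]
  map_mul' a b := by
    apply Subtype.ext
    apply Subtype.ext
    simp [Spin.coe_toSL, Spin.conj_mul, LinearMap.toMatrix'_comp]

/-! ## The group `Spin^G(s,t)` -/

/-- A central subgroup of order two in a group, given by its generator (written `-1`). -/
structure CentralZ2 (G : Type*) [Group G] where
  /-- The generator of the central subgroup. -/
  negOne : G
  mem_center : negOne ∈ Subgroup.center G
  ne_one : negOne ≠ 1
  mul_self : negOne * negOne = 1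

section SpinG

variable (s t : ℕ) {G : Type*} [Group G] (c : CentralZ2 G)

/-- The diagonal subgroup `{(1,1), (-1,-1)}` of `Spin(s,t) × G`. -/
def diagZ2 : Subgroup (Spin s t × G) where
  carrier := {1, (Spin.negOne s t, c.negOne)}
  one_mem' := Or.inl rfl
  mul_mem' := by
    have h : (Spin.negOne s t, c.negOne) * (Spin.negOne s t, c.negOne) = 1 :=
      Prod.ext (Subtype.ext (by simp [Spin.negOne])) c.mul_self
    rintro a b (rfl | rfl) (rfl | rfl)
    · exact Or.inl (one_mul 1)
    · exact Or.inr (one_mul _)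
    · exact Or.inr (mul_one _)
    · exact Or.inl h
  inv_mem' := by
    have h : (Spin.negOne s t, c.negOne) * (Spin.negOne s t, c.negOne) = 1 :=
      Prod.ext (Subtype.ext (by simp [Spin.negOne])) c.mul_self
    rintro a (rfl | rfl)
    · exact Or.inl inv_one
    · exact Or.inr (inv_eq_of_mul_eq_one_right h)

instance diagZ2_normal : (diagZ2 s t c).Normal where
  conj_mem := by
    have hc : ∀ g : Spin s t × G, g * (Spin.negOne s t, c.negOne) * g⁻¹
        = (Spin.negOne s t, c.negOne) := by
      intro g
      rw [mul_inv_eq_iff_eq_mul]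
      refine Prod.ext (Subtype.ext ?_) ?_
      · apply Units.ext
        simp [Spin.negOne]
      · exact Subgroup.mem_center_iff.1 c.mem_center g.2
    rintro a (rfl | rfl) g
    · exact Or.inl (by simp)
    · exact Or.inr (hc g)

/-- `Spin^G(s,t) = (Spin(s,t) × G) / {(1,1), (-1,-1)}`. -/
abbrev SpinG : Type _ := (Spin s t × G) ⧸ diagZ2 s t c

/-- The class `[a, g]` in `Spin^G(s,t)`, as the quotient homomorphism `Spin × G → Spin^G`. -/
def SpinG.mk : Spin s t × G →* SpinG s t c := QuotientGroup.mk' (diagZ2 s t c)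

/-- The homomorphism `Spin^G(s,t) → SO(s,t)`, `[a, g] ↦ π(a)`. -/
def SpinG.πHat : SpinG s t c →* SO s t :=
  QuotientGroup.lift (diagZ2 s t c) ((Spin.π s t).comp (MonoidHom.fst (Spin s t) G)) (by
    rintro a (rfl | rfl)
    · exact map_one _
    · apply Subtype.ext
      apply Subtype.ext
      simp [Spin.π, Spin.coe_toSL, Spin.conj_negOne])

/-- The subgroup `Spin₀^G(s,t) = Spin₀(s,t) ×_{ℤ₂} G` of the classes `[a, g]` with
`a ∈ Spin₀(s,t)` and `g ∈ G`. -/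
def SpinG₀ : Subgroup (SpinG s t c) := ((Spin₀ s t).prod ⊤).map (SpinG.mk s t c)

/-- The smooth structure of `Spin^G(s,t)`, when `G` is a Lie group modelled on `EG`, recorded by
its smooth parametrised families: it is generated by the maps `x ↦ [a(x), g(x)]` with
`a : ℝⁿ → Spin(s,t)` smooth as a map to the vector space `Cl(s,t)` (that is, in coordinates) and
`g : ℝⁿ → G` smooth. This is the smooth structure for which `Spin × G → Spin^G` is a local
diffeomorphism, `Spin` being a closed submanifold of `Cl`. -/
abbrev SpinG.smoothStructure (EG : Type*) [NormedAddCommGroup EG] [NormedSpace ℝ EG]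
    [TopologicalSpace G] [ChartedSpace EG G] : DiffeologicalSpace (SpinG s t c) :=
  DiffeologicalSpace.generateFrom
    {k | ∃ (a : EuclideanSpace ℝ (Fin k.1) → Spin s t) (g : EuclideanSpace ℝ (Fin k.1) → G),
      (∀ φ : Module.Dual ℝ (Cl s t), ContDiff ℝ ∞ fun x => φ ((a x : (Cl s t)ˣ) : Cl s t)) ∧
      ContMDiff 𝓘(ℝ, EuclideanSpace ℝ (Fin k.1)) 𝓘(ℝ, EG) ∞ g ∧
      k.2 = fun x => SpinG.mk s t c (a x, g x)}

end SpinG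

/-! ## Principal bundles and reductions of the structure group -/

/-- A smooth principal bundle over the manifold `M` whose total space is the manifold `P` and
whose structure group is `K`, with the smooth structure `d`. -/
structure SmoothPrincipalBundle (E : Type*) [NormedAddCommGroup E] [NormedSpace ℝ E]
    (M : Type*) [TopologicalSpace M] [ChartedSpace E M]
    (EP : Type*) [NormedAddCommGroup EP] [NormedSpace ℝ EP]
    (P : Type*) [TopologicalSpace P] [ChartedSpace EP P]
    (K : Type*) [Group K] (d : DiffeologicalSpace K) where
  /-- The projection. -/
  proj : P → M
  contMDiff_proj : ContMDiff 𝓘(ℝ, EP) 𝓘(ℝ, E) ∞ proj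
  /-- The right action of the structure group. -/
  act : P → K → P
  act_one : ∀ p, act p 1 = p
  act_mul : ∀ p k l, act p (k * l) = act (act p k) l
  proj_act : ∀ p k, proj (act p k) = proj p
  /-- The action is simply transitive on the fibres. -/
  existsUnique_act : ∀ p q, proj p = proj q → ∃! k, act p k = q
  /-- The action `P × K → P` is smooth. -/
  contMDiff_act : ∀ (n : ℕ) (k : EuclideanSpace ℝ (Fin n) → K), k ∈ d.plots n →
    ContMDiff (𝓘(ℝ, EuclideanSpace ℝ (Fin n)).prod 𝓘(ℝ, EP)) 𝓘(ℝ, EP) ∞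
      fun x : EuclideanSpace ℝ (Fin n) × P => act x.2 (k x.1)
  /-- Local triviality: over a neighbourhood `U` of any point there are a smooth section `σ` and a
  smooth map `κ` from the part of `P` over `U` to `K` such that `p ↦ (proj p, κ p)` is the inverse
  of the equivariant map `(y, k) ↦ σ(y) k` from `U × K`. -/
  locally_trivial : ∀ x : M, ∃ U : Set M, IsOpen U ∧ x ∈ U ∧ ∃ (σ : M → P) (κ : P → K),
    ContMDiffOn 𝓘(ℝ, E) 𝓘(ℝ, EP) ∞ σ U ∧ (∀ y ∈ U, proj (σ y) = y) ∧
    (∀ p, proj p ∈ U → act (σ (proj p)) (κ p) = p) ∧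
    ∀ (n : ℕ) (q : EuclideanSpace ℝ (Fin n) → P),
      ContMDiff 𝓘(ℝ, EuclideanSpace ℝ (Fin n)) 𝓘(ℝ, EP) ∞ q → (∀ y, proj (q y) ∈ U) →
      κ ∘ q ∈ d.plots n

/-- Let `proj : F → M` be a principal bundle with right action `act` of `K`, and let
`smoothOn U σ` say that `σ` is smooth on `U`. A subset `F₀` of `F` is a reduction of the structure
group to the subgroup `H` if it is a principal `H`-subbundle: near each point there is a smooth
section `σ` of `F` such that `F₀` consists locally of the points `σ(y) h` with `h ∈ H`. -/
def IsReduction {M F K : Type*} [TopologicalSpace M] [Group K] (proj : F → M) (act : F → K → F)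
    (smoothOn : Set M → (M → F) → Prop) (H : Subgroup K) (F₀ : Set F) : Prop :=
  ∀ x : M, ∃ U : Set M, IsOpen U ∧ x ∈ U ∧ ∃ σ : M → F,
    smoothOn U σ ∧ (∀ y ∈ U, proj (σ y) = y) ∧
    ∀ f, proj f ∈ U → (f ∈ F₀ ↔ ∃ h ∈ H, f = act (σ (proj f)) h)

/-! ## Oriented pseudo-Riemannian manifolds and their frames -/

section Geometry

variable (s t : ℕ) (E : Type*) [NormedAddCommGroup E] [NormedSpace ℝ E]
  (M : Type*) [TopologicalSpace M] [ChartedSpace E M]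

/-- A smooth pseudo-Riemannian metric of signature `(s,t)` on `M`. -/
structure PseudoRiemannianMetric [IsManifold 𝓘(ℝ, E) ∞ M] where
  /-- The bilinear form on each tangent space. -/
  val : ∀ x : M, TangentSpace 𝓘(ℝ, E) x →L[ℝ] TangentSpace 𝓘(ℝ, E) x →L[ℝ] ℝ
  symm : ∀ x v w, val x v w = val x w v
  signature : ∀ x, ∃ e : (Idx s t → ℝ) ≃ₗ[ℝ] TangentSpace 𝓘(ℝ, E) x,
    ∀ v, val x (e v) (e v) = stdForm s t v
  contMDiff : ContMDiff 𝓘(ℝ, E) (𝓘(ℝ, E).prod 𝓘(ℝ, E →L[ℝ] E →L[ℝ] ℝ)) ∞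
    fun x => Bundle.TotalSpace.mk' (E →L[ℝ] E →L[ℝ] ℝ) x (val x)

/-- An orientation of the `(s+t)`-dimensional manifold `M`: an orientation of each tangent space
that is represented, near each point, by a smooth local frame. -/
structure ManifoldOrientation [IsManifold 𝓘(ℝ, E) ∞ M] where
  /-- The orientation of each tangent space. -/
  val : ∀ x : M, Orientation ℝ (TangentSpace 𝓘(ℝ, E) x) (Idx s t)
  locally_frame : ∀ x : M, ∃ U : Set M, IsOpen U ∧ x ∈ U ∧
    ∃ X : Idx s t → ∀ y : M, TangentSpace 𝓘(ℝ, E) y,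
      (∀ i, ContMDiffOn 𝓘(ℝ, E) 𝓘(ℝ, E).tangent ∞
        (fun y => (⟨y, X i y⟩ : TangentBundle 𝓘(ℝ, E) M)) U) ∧
      ∀ y ∈ U, ∃ b : Module.Basis (Idx s t) ℝ (TangentSpace 𝓘(ℝ, E) y),
        (∀ i, b i = X i y) ∧ b.orientation = val y

variable {s t E M} [IsManifold 𝓘(ℝ, E) ∞ M]

/-- The special orthonormal frame bundle `F_SO`: a point is an orientation-preserving linear
isometry from `ℝ^{s,t}` to a tangent space of `M`. -/
structure SOFrame (g : PseudoRiemannianMetric s t E M) (o : ManifoldOrientation s t E M) where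
  /-- The base point of the frame. -/
  base : M
  /-- The frame as a linear isomorphism. -/
  toEquiv : (Idx s t → ℝ) ≃ₗ[ℝ] TangentSpace 𝓘(ℝ, E) base
  isometry : ∀ v, g.val base (toEquiv v) (toEquiv v) = stdForm s t v
  oriented : ((Pi.basisFun ℝ (Idx s t)).map toEquiv).orientation = o.val base

namespace SOFrame

variable {g : PseudoRiemannianMetric s t E M} {o : ManifoldOrientation s t E M}

/-- The `i`-th vector of a frame, as a point of the tangent bundle. -/
def vec (f : SOFrame g o) (i : Idx s t) : TangentBundle 𝓘(ℝ, E) M :=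
  ⟨f.base, f.toEquiv (Pi.single i 1)⟩

/-- The right action of `SO(s,t)` on frames, by precomposition. -/
def act (f : SOFrame g o) (A : SO s t) : SOFrame g o where
  base := f.base
  toEquiv := (Matrix.SpecialLinearGroup.toLin' (A : Matrix.SpecialLinearGroup (Idx s t) ℝ)).trans
    f.toEquiv
  isometry v := (f.isometry _).trans (A.2 v)
  oriented := by
    rw [← f.oriented, Module.Basis.orientation_map, Module.Basis.orientation_map]
    have h : (Pi.basisFun ℝ (Idx s t)).orientation = Orientation.map (Idx s t)
        (Matrix.SpecialLinearGroup.toLin' (A : Matrix.SpecialLinearGroup (Idx s t) ℝ))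
        (Pi.basisFun ℝ (Idx s t)).orientation := by
      rw [← Module.Basis.orientation_map, eq_comm,
        Module.Basis.orientation_comp_linearEquiv_eq_iff_det_pos,
        Matrix.SpecialLinearGroup.toLin'_to_linearMap, LinearMap.det_toLin']
      simp
    conv_rhs => rw [h]
    rfl

/-- A family of frames parametrised by `M` is smooth on `U` if its vectors are. -/
def SmoothOn (U : Set M) (σ : M → SOFrame g o) : Prop :=
  ∀ i, ContMDiffOn 𝓘(ℝ, E) 𝓘(ℝ, E).tangent ∞ (fun y => (σ y).vec i) U

end SOFrame

/-- `(M, g)` is time-orientable if the structure group of `F_SO` reduces to `SO₀(s,t)`. -/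
def TimeOrientable (g : PseudoRiemannianMetric s t E M) (o : ManifoldOrientation s t E M) : Prop :=
  ∃ F₀ : Set (SOFrame g o),
    IsReduction SOFrame.base SOFrame.act SOFrame.SmoothOn (SO₀ s t) F₀

/-- A spin-`G` structure on the oriented pseudo-Riemannian manifold `(M, g)`, with total space the
manifold `P`: a principal `Spin^G(s,t)`-bundle with a smooth equivariant bundle map to `F_SO`. -/
structure SpinGStructure (g : PseudoRiemannianMetric s t E M) (o : ManifoldOrientation s t E M)
    (EG : Type*) [NormedAddCommGroup EG] [NormedSpace ℝ EG]
    {G : Type*} [Group G] [TopologicalSpace G] [ChartedSpace EG G] (c : CentralZ2 G)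
    (EP : Type*) [NormedAddCommGroup EP] [NormedSpace ℝ EP]
    (P : Type*) [TopologicalSpace P] [ChartedSpace EP P]
    extends SmoothPrincipalBundle E M EP P (SpinG s t c) (SpinG.smoothStructure s t c EG) where
  /-- The bundle map to the special orthonormal frame bundle. -/
  frame : P → SOFrame g o
  base_frame : ∀ p, (frame p).base = proj p
  contMDiff_frame : ∀ i, ContMDiff 𝓘(ℝ, EP) 𝓘(ℝ, E).tangent ∞ fun p => (frame p).vec i
  frame_act : ∀ p k, frame (act p k) = (frame p).act (SpinG.πHat s t c k)

/-- The structure group of a principal `K`-bundle reduces to the subgroup `H`. -/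
def SmoothPrincipalBundle.ReducesTo {EP P K : Type*} [NormedAddCommGroup EP] [NormedSpace ℝ EP]
    [TopologicalSpace P] [ChartedSpace EP P] [Group K] {d : DiffeologicalSpace K}
    (B : SmoothPrincipalBundle E M EP P K d) (H : Subgroup K) : Prop :=
  ∃ P₀ : Set P, IsReduction B.proj B.act
    (fun U σ => ContMDiffOn 𝓘(ℝ, E) 𝓘(ℝ, EP) ∞ σ U) H P₀

end Geometry

end

/-! The theorem rests on one identity of groups, `SpinG.comap_SO₀`: the preimage of `SO₀` under
`SpinG.πHat` is exactly `SpinG₀`. Given it, reductions pass along the bundle map `frame`. A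
reduction `F₀` of the frame bundle pulls back to its preimage, and a reduction `P₀` pushes forward
to the `SO₀`-saturation of its image.

Smooth local sections must accompany these sets. Pushing forward, one composes with `frame`. Pulling
back, one starts from any local section of `P` and compares its image with a section of `F₀`. The
transition function is continuous at the point, so after right translation by a constant element it
takes values in the open subgroup `SO₀` nearby. This uses surjectivity of `Spin.π`.

The identity of groups needs two facts about `Spin.π`. (1) The kernel is `{1, -1}`: an even element
commuting with all vectors is annihilated by every contraction, hence is a scalar, and its spinor
norm `±1` makes the scalar `±1`. (2) `Spin₀` maps onto `SO₀`: the image is connected, and it is open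
because an isometry near the identity is a product of pairs of reflections whose mirror vectors can
be joined through non-null vectors. The same reduction to reflections, in the style of Cartan and
Dieudonné, gives surjectivity of `Spin.π`. -/

noncomputable section

/-! ## Even central elements of a Clifford algebra -/

namespace CliffordAlgebra

/-- Both sides kill scalars and obey the same twisted Leibniz rule under left multiplication by a
vector, because `v a + a v` is the polar form of `v` and `a`. For even `x` the right side is the
commutator with `v`, which turns centrality into vanishing contractions. -/
theorem contractLeft_polarBilin {R V : Type*} [CommRing R] [AddCommGroup V] [Module R V]
    (Q : QuadraticForm R V) (v : V) (x : CliffordAlgebra Q) :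
    contractLeft (Q.polarBilin v) x = ι Q v * x - involute x * ι Q v := by
  induction x using CliffordAlgebra.left_induction with
  | algebraMap r =>
    rw [contractLeft_algebraMap, AlgHom.commutes, Algebra.commutes, sub_self]
  | add x y hx hy => rw [map_add, map_add, hx, hy]; noncomm_ring
  | ι_mul x a hx =>
    have h := ι_mul_ι_add_swap (Q := Q) v a
    rw [contractLeft_ι_mul, hx, map_mul, involute_ι, Algebra.smul_def]
    change algebraMap R _ (QuadraticMap.polar Q v a) * x - _ = _
    rw [← h]
    noncomm_ring

end CliffordAlgebra

/-! ### The degree operator on the exterior algebra -/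

namespace ExteriorAlgebra

variable {K V I : Type*} [Field K] [AddCommGroup V] [Module K V] [Fintype I]

/-- The Euler operator, which multiplies an element of degree `k` by `k`. -/
def euler (b : Module.Basis I K V) : ExteriorAlgebra K V →ₗ[K] ExteriorAlgebra K V :=
  ∑ i, LinearMap.mulLeft K (ι K (b i)) ∘ₗ CliffordAlgebra.contractLeft (b.coord i)

theorem euler_apply (b : Module.Basis I K V) (x : ExteriorAlgebra K V) :
    euler b x = ∑ i, ι K (b i) * CliffordAlgebra.contractLeft (b.coord i) x := by
  simp [euler]

/-- Contraction is an antiderivation. The sign from moving it past `v` cancels the sign from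
anticommuting `v` with `b i`, and the remaining terms sum to the basis expansion of `v`. -/
theorem euler_ι_mul (b : Module.Basis I K V) (v : V) (x : ExteriorAlgebra K V) :
    euler b (ι K v * x) = ι K v * x + ι K v * euler b x := by
  have h : ∀ i, ι K (b i) * CliffordAlgebra.contractLeft (b.coord i) (ι K v * x)
      = ι K (b.repr v i • b i) * x
        + ι K v * (ι K (b i) * CliffordAlgebra.contractLeft (b.coord i) x) := by
    intro i
    have h1 : CliffordAlgebra.contractLeft (b.coord i) (ι K v * x)
      = b.coord i v • x - ι K v * CliffordAlgebra.contractLeft (b.coord i) x :=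
      CliffordAlgebra.contractLeft_ι_mul _ _ _
    have h2 : ι K (b i) * ι K v = - (ι K v * ι K (b i)) :=
      eq_neg_of_add_eq_zero_left (ι_add_mul_swap _ _)
    rw [h1, mul_sub, ← mul_assoc, h2, map_smul, Module.Basis.coord_apply, mul_smul_comm,
      smul_mul_assoc, neg_mul, sub_neg_eq_add, mul_assoc]
  rw [euler_apply, Finset.sum_congr rfl fun i _ => h i, Finset.sum_add_distrib, ← Finset.sum_mul,
    ← map_sum, b.sum_repr, ← Finset.mul_sum, ← euler_apply]

theorem euler_of_mem (b : Module.Basis I K V) (k : ℕ) {x : ExteriorAlgebra K V}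
    (hx : x ∈ ⋀[K]^k V) : euler b x = (k : K) • x := by
  induction hx using Submodule.pow_induction_on_left' with
  | algebraMap r =>
    have h : ∀ i, CliffordAlgebra.contractLeft (b.coord i)
        (algebraMap K (ExteriorAlgebra K V) r) = 0 :=
      fun i => CliffordAlgebra.contractLeft_algebraMap _ _ _
    simp [euler_apply, h]
  | add x y i _ _ hx hy => rw [map_add, hx, hy, smul_add]
  | mem_mul m hm i x _ hx =>
    obtain ⟨v, rfl⟩ := hm
    rw [euler_ι_mul, hx, mul_smul_comm, Nat.cast_succ, add_smul, one_smul, add_comm]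

/-- The operator multiplies the degree `k` component by `k`, which is invertible in characteristic
zero unless `k = 0`; so only the scalar component survives. -/
theorem mem_range_algebraMap_of_euler_eq_zero [CharZero K] (b : Module.Basis I K V)
    {x : ExteriorAlgebra K V} (hx : euler b x = 0) : ∃ r, x = algebraMap K _ r := by
  have key : ∀ (y : ExteriorAlgebra K V) (k : ℕ),
      GradedRing.proj (fun i => ⋀[K]^i V) k (euler b y)
        = (k : K) • GradedRing.proj (fun i => ⋀[K]^i V) k y := by
    intro y k
    induction y using DirectSum.Decomposition.inductionOn (fun i => ⋀[K]^i V) with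
    | zero => simp
    | add y z hy hz => rw [map_add, map_add, map_add, hy, hz, smul_add]
    | @homogeneous i m =>
      have hi : euler b (m : ExteriorAlgebra K V) = ((i : K) • m : ⋀[K]^i V) :=
        euler_of_mem b i m.2
      rw [hi, GradedRing.proj_apply, GradedRing.proj_apply, DirectSum.decompose_coe,
        DirectSum.decompose_coe]
      by_cases hik : i = k
      · subst hik
        simp
      · rw [DirectSum.of_eq_of_ne _ _ _ (Ne.symm hik), DirectSum.of_eq_of_ne _ _ _ (Ne.symm hik)]
        simp
  have h0 : x = GradedRing.proj (fun i => ⋀[K]^i V) 0 x := by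
    classical
    conv_lhs => rw [← DirectSum.sum_support_decompose (fun i => ⋀[K]^i V) x]
    rw [GradedRing.proj_apply]
    by_cases hs : 0 ∈ (DirectSum.decompose (fun i => ⋀[K]^i V) x).support
    · refine Finset.sum_eq_single_of_mem 0 hs fun k _ hk => ?_
      have h := key x k
      rw [hx, map_zero, eq_comm, smul_eq_zero] at h
      exact h.resolve_left (Nat.cast_ne_zero.2 hk)
    · rw [DFinsupp.notMem_support_iff.1 hs]
      refine Finset.sum_eq_zero fun k hk => ?_
      have h := key x k
      rw [hx, map_zero, eq_comm, smul_eq_zero] at h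
      exact h.resolve_left (Nat.cast_ne_zero.2 (by rintro rfl; exact hs hk))
  have hm : x ∈ ⋀[K]^0 V := by
    rw [h0, GradedRing.proj_apply]
    exact Subtype.property _
  rw [ExteriorAlgebra.exteriorPower, pow_zero, Submodule.mem_one] at hm
  obtain ⟨r, hr⟩ := hm
  exact ⟨r, hr.symm⟩

end ExteriorAlgebra

/-- The linear isomorphism with the exterior algebra commutes with contractions, so there the degree
operator kills the image of `x`. -/
theorem CliffordAlgebra.mem_range_algebraMap_of_contractLeft_eq_zero {K V I : Type*} [Field K]
    [CharZero K] [AddCommGroup V] [Module K V] [Fintype I] (b : Module.Basis I K V)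
    (Q : QuadraticForm K V) {x : CliffordAlgebra Q} (hx : ∀ d, contractLeft d x = 0) :
    ∃ r, x = algebraMap K _ r := by
  have : Invertible (2 : K) := invertibleOfNonzero two_ne_zero
  obtain ⟨r, hr⟩ := ExteriorAlgebra.mem_range_algebraMap_of_euler_eq_zero b
    (x := equivExterior Q x) (by
      rw [ExteriorAlgebra.euler_apply]
      refine Finset.sum_eq_zero fun i _ => ?_
      have h : contractLeft (b.coord i) (equivExterior Q x)
          = equivExterior Q (contractLeft (b.coord i) x) :=
        (changeForm_contractLeft changeForm.associated_neg_proof _ _).symm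
      rw [h, hx, map_zero, mul_zero])
  refine ⟨r, (equivExterior Q).injective ?_⟩
  rw [hr]
  exact (changeForm_algebraMap changeForm.associated_neg_proof _).symm

/-! ## The quadratic form -/

/-- The sign of the `i`-th standard basis vector of `ℝ^{s,t}`. -/
def idxSign {s t : ℕ} : Idx s t → ℝ := Sum.elim (fun _ => 1) (fun _ => -1)

theorem idxSign_mul_self {s t : ℕ} (i : Idx s t) : idxSign i * idxSign i = 1 := by
  rcases i with i | i <;> simp [idxSign]

theorem idxSign_ne_zero {s t : ℕ} (i : Idx s t) : idxSign i ≠ 0 := fun h => by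
  have := idxSign_mul_self i
  rw [h] at this
  norm_num at this

theorem stdForm_apply {s t : ℕ} (v : Idx s t → ℝ) :
    stdForm s t v = ∑ i, idxSign i * (v i * v i) := by
  simp [stdForm, QuadraticMap.weightedSumSquares_apply, idxSign]

theorem polar_stdForm {s t : ℕ} (v w : Idx s t → ℝ) :
    QuadraticMap.polar (stdForm s t) v w = ∑ i, 2 * idxSign i * (v i * w i) := by
  simp only [QuadraticMap.polar, stdForm_apply, ← Finset.sum_sub_distrib, Pi.add_apply]
  exact Finset.sum_congr rfl fun i _ => by ring

theorem polar_stdForm_single {s t : ℕ} (v : Idx s t → ℝ) (i : Idx s t) :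
    QuadraticMap.polar (stdForm s t) v (Pi.single i 1) = 2 * idxSign i * v i := by
  rw [polar_stdForm, Finset.sum_eq_single i]
  · simp
  · intro j _ hj
    simp [hj]
  · simp

theorem stdForm_single {s t : ℕ} (i : Idx s t) :
    stdForm s t (Pi.single i 1) = idxSign i := by
  rw [stdForm_apply, Finset.sum_eq_single i]
  · simp
  · intro j _ hj
    simp [hj]
  · simp

theorem exists_polarBilin_eq {s t : ℕ} (d : Module.Dual ℝ (Idx s t → ℝ)) :
    ∃ v, QuadraticMap.polarBilin (stdForm s t) v = d := by
  -- Each sign is its own inverse, and the polar form carries a factor `2`.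
  refine ⟨fun i => idxSign i / 2 * d (Pi.single i 1), ?_⟩
  refine (Pi.basisFun ℝ (Idx s t)).ext fun i => ?_
  rw [Pi.basisFun_apply]
  change QuadraticMap.polar (stdForm s t) _ _ = _
  rw [polar_stdForm_single]
  linear_combination d (Pi.single i 1) * idxSign_mul_self i

/-! ## The kernel of `Spin(s,t) → SO(s,t)` -/

namespace Spin

variable {s t : ℕ}

/-- The underlying element of the Clifford algebra. -/
abbrev toCl (a : Spin s t) : Cl s t := ((a : (Cl s t)ˣ) : Cl s t)

theorem toCl_injective : Function.Injective (toCl (s := s) (t := t)) :=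
  fun _ _ h => Subtype.ext (Units.ext h)

theorem involute_toCl (a : Spin s t) : CliffordAlgebra.involute (toCl a) = (toCl a) := by
  obtain ⟨u, hu⟩ := a
  unfold Spin at hu
  simp only [toCl]
  induction hu using Subgroup.closure_induction with
  | mem u hu =>
    rcases hu with hu | ⟨v, w, hv, hw, hu⟩
    · rw [Set.mem_singleton_iff] at hu
      simp [hu]
    · rw [hu, map_mul, CliffordAlgebra.involute_ι, CliffordAlgebra.involute_ι, neg_mul_neg]
  | one => simp
  | mul u w _ _ hu hw => rw [Units.val_mul, map_mul, hu, hw]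
  | inv u _ hu =>
    refine (Units.mul_right_inj u).1 ?_
    rw [Units.mul_inv]
    nth_rw 1 [← hu]
    rw [← map_mul, Units.mul_inv, map_one]

/-- Reversal fixes vectors and reverses products, so `v w` times its reverse collapses to the
product of the two norms. The scalar is central, hence multiplicative; `r * r = 1` encodes `r = ±1`.
-/
theorem exists_mul_reverse (a : Spin s t) : ∃ r : ℝ, r * r = 1 ∧
    (toCl a) * CliffordAlgebra.reverse (toCl a) = algebraMap ℝ _ r := by
  obtain ⟨u, hu⟩ := a
  unfold Spin at hu
  simp only [toCl]
  induction hu using Subgroup.closure_induction with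
  | mem u hu =>
    rcases hu with hu | ⟨v, w, hv, hw, hu⟩
    · rw [Set.mem_singleton_iff] at hu
      exact ⟨1, by simp [hu]⟩
    · refine ⟨stdForm s t v * stdForm s t w, ?_, ?_⟩
      · rcases hv with hv | hv <;> rcases hw with hw | hw <;> simp [hv, hw]
      · rw [hu, CliffordAlgebra.reverse.map_mul, CliffordAlgebra.reverse_ι,
          CliffordAlgebra.reverse_ι, mul_assoc, ← mul_assoc (CliffordAlgebra.ι _ w),
          CliffordAlgebra.ι_sq_scalar, Algebra.commutes, ← mul_assoc, CliffordAlgebra.ι_sq_scalar,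
          map_mul]
  | one => exact ⟨1, by simp⟩
  | mul u w _ _ hu hw =>
    obtain ⟨p, hp, hp'⟩ := hu
    obtain ⟨q, hq, hq'⟩ := hw
    refine ⟨p * q, by linear_combination hp * (q * q) + hq, ?_⟩
    rw [Units.val_mul, CliffordAlgebra.reverse.map_mul, mul_assoc, ← mul_assoc (w : Cl s t), hq',
      Algebra.commutes, ← mul_assoc, hp', map_mul]
  | inv u _ hu =>
    obtain ⟨p, hp, hp'⟩ := hu
    have h : ((u⁻¹ : (Cl s t)ˣ) : Cl s t)
        = CliffordAlgebra.reverse (u : Cl s t) * algebraMap ℝ _ p := by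
      rw [Units.inv_eq_of_mul_eq_one_right]
      rw [← mul_assoc, hp', ← map_mul, hp, map_one]
    refine ⟨p, hp, ?_⟩
    have h2 : CliffordAlgebra.reverse ((u⁻¹ : (Cl s t)ˣ) : Cl s t)
        = algebraMap ℝ _ p * (u : Cl s t) := by
      rw [h, CliffordAlgebra.reverse.map_mul, CliffordAlgebra.reverse.commutes,
        CliffordAlgebra.reverse_reverse]
    rw [h2, Algebra.commutes, ← mul_assoc, Units.inv_mul, one_mul]

/-- This writes the inverse as a polynomial expression in the element and its reverse, from which
continuity of conjugation is immediate. -/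
theorem toCl_inv (a : Spin s t) : toCl a⁻¹ = CliffordAlgebra.reverse (toCl a) *
    ((toCl a) * CliffordAlgebra.reverse (toCl a)) := by
  obtain ⟨r, hr, h⟩ := exists_mul_reverse a
  refine Units.inv_eq_of_mul_eq_one_right (u := (a : (Cl s t)ˣ)) ?_
  rw [← mul_assoc]
  change (toCl a) * _ * ((toCl a) * _) = 1
  rw [h, ← map_mul, hr, map_one]

theorem eq_one_or_eq_negOne_of_conj_eq_id {a : Spin s t} (ha : conj a = LinearMap.id) :
    a = 1 ∨ a = negOne s t := by
  obtain ⟨r, hr⟩ := CliffordAlgebra.mem_range_algebraMap_of_contractLeft_eq_zero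
    (Pi.basisFun ℝ (Idx s t)) (stdForm s t) (x := (toCl a)) (by
      intro d
      obtain ⟨v, rfl⟩ := exists_polarBilin_eq d
      rw [CliffordAlgebra.contractLeft_polarBilin, involute_toCl, Spin.mul_ι, ha]
      exact sub_self _)
  obtain ⟨p, hp, hp'⟩ := exists_mul_reverse a
  rw [hr, CliffordAlgebra.reverse.commutes, ← map_mul] at hp'
  have hrp : r * r = p := (algebraMap ℝ (Cl s t)).injective hp'
  -- Of `p = ±1`, the value `-1` is excluded because `p = r * r` is nonnegative.
  have hr2 : r * r = 1 := by nlinarith [mul_self_nonneg r]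
  rcases mul_self_eq_one_iff.1 hr2 with rfl | rfl
  · exact Or.inl (toCl_injective (by rw [hr]; simp [toCl]))
  · exact Or.inr (toCl_injective (by rw [hr]; simp [toCl, negOne]))

end Spin

/-! ## Continuity of `Spin(s,t) → SO(s,t)` -/

instance Cl.finite (s t : ℕ) : Module.Finite ℝ (Cl s t) := by
  -- The basis of the exterior algebra is built from a linear order on the index set; any order will
  -- do.
  let : LinearOrder (Idx s t) := inferInstanceAs (LinearOrder (Fin s ⊕ₗ Fin t))
  have : Module.Finite ℝ (ExteriorAlgebra ℝ (Idx s t → ℝ)) :=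
    Module.Finite.of_basis (Pi.basisFun ℝ (Idx s t)).ExteriorAlgebra
  exact Module.Finite.equiv (CliffordAlgebra.equivExterior (stdForm s t)).symm

theorem Spin.continuous_conj_apply {s t : ℕ} (x : Idx s t → ℝ) :
    Continuous fun a : Spin s t => Spin.conj a x := by
  let : TopologicalSpace (Cl s t) := moduleTopology ℝ (Cl s t)
  have : IsModuleTopology ℝ (Cl s t) := ⟨rfl⟩
  have : IsTopologicalRing (Cl s t) := IsModuleTopology.isTopologicalRing ℝ (Cl s t)
  have h : Continuous (Spin.toCl (s := s) (t := t)) := continuous_induced_dom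
  have hrev : Continuous (CliffordAlgebra.reverse (Q := stdForm s t)) :=
    IsModuleTopology.continuous_of_linearMap _
  have hvec : Continuous (Cl.toVector s t) := IsModuleTopology.continuous_of_linearMap _
  have heq : ∀ a : Spin s t, Spin.conj a x = Cl.toVector s t ((Spin.toCl a) *
      CliffordAlgebra.ι (stdForm s t) x * (CliffordAlgebra.reverse (Spin.toCl a) *
        ((Spin.toCl a) * CliffordAlgebra.reverse (Spin.toCl a)))) := by
    intro a
    rw [← Spin.toCl_inv]
    rfl
  simp_rw [heq]
  fun_prop

theorem Spin.continuous_π (s t : ℕ) : Continuous (Spin.π s t) := by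
  refine Continuous.subtype_mk (Continuous.subtype_mk ?_ _) _
  refine continuous_matrix fun i j => ?_
  simp only [LinearMap.toMatrix'_apply]
  exact (continuous_apply i).comp (Spin.continuous_conj_apply _)

/-! ## Reflections -/

section Reflection

variable {s t : ℕ}

local notation "B" => QuadraticMap.polar (stdForm s t)

/-- The reflection of `ℝ^{s,t}` in the hyperplane orthogonal to the non-null vector `v`. -/
def reflect (v : Idx s t → ℝ) : (Idx s t → ℝ) →ₗ[ℝ] (Idx s t → ℝ) :=
  LinearMap.transvection ((-(stdForm s t v)⁻¹) • QuadraticMap.polarBilin (stdForm s t) v) v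

theorem reflect_apply (v x : Idx s t → ℝ) :
    reflect v x = x - ((stdForm s t v)⁻¹ * B v x) • v := by
  rw [reflect, LinearMap.transvection.apply, LinearMap.smul_apply]
  change x + (-(stdForm s t v)⁻¹ * B v x) • v = _
  module

theorem stdForm_sub_smul (x v : Idx s t → ℝ) (c : ℝ) :
    stdForm s t (x - c • v) = stdForm s t x + c * c * stdForm s t v - c * B v x := by
  rw [sub_eq_add_neg, ← neg_smul, QuadraticMap.map_add (stdForm s t), QuadraticMap.map_smul,
    QuadraticMap.polar_smul_right, QuadraticMap.polar_comm, smul_eq_mul, smul_eq_mul]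
  ring

theorem reflect_of_polar_eq_zero {v x : Idx s t → ℝ} (h : B v x = 0) : reflect v x = x := by
  rw [reflect_apply, h, mul_zero, zero_smul, sub_zero]

theorem stdForm_refl {v : Idx s t → ℝ} (hv : stdForm s t v ≠ 0) (x : Idx s t → ℝ) :
    stdForm s t (reflect v x) = stdForm s t x := by
  rw [reflect_apply, stdForm_sub_smul]
  field_simp
  ring

theorem reflect_refl {v : Idx s t → ℝ} (hv : stdForm s t v ≠ 0) (x : Idx s t → ℝ) :
    reflect v (reflect v x) = x := by
  rw [reflect_apply v (reflect v x), reflect_apply v x, QuadraticMap.polar_sub_right,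
    QuadraticMap.polar_smul_right, QuadraticMap.polar_self, sub_sub, ← add_smul]
  convert sub_zero x
  rw [smul_eq_zero]
  left
  rw [two_nsmul, smul_eq_mul]
  field_simp
  ring

theorem reflect_comp_refl {v : Idx s t → ℝ} (hv : stdForm s t v ≠ 0) :
    reflect v ∘ₗ reflect v = LinearMap.id := LinearMap.ext (reflect_refl hv)

theorem det_refl {v : Idx s t → ℝ} (hv : stdForm s t v ≠ 0) :
    LinearMap.det (reflect v) = -1 := by
  rw [reflect, LinearMap.transvection.det, LinearMap.smul_apply]
  change 1 + -(stdForm s t v)⁻¹ * B v v = -1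
  rw [QuadraticMap.polar_self, two_nsmul]
  field_simp
  norm_num

theorem reflect_smul {c : ℝ} (hc : c ≠ 0) (v : Idx s t → ℝ) : reflect (c • v) = reflect v := by
  refine LinearMap.ext fun x => ?_
  rw [reflect_apply, reflect_apply, QuadraticMap.map_smul, QuadraticMap.polar_smul_left, smul_smul,
    smul_eq_mul, smul_eq_mul]
  congr 2
  by_cases hv : stdForm s t v = 0
  · simp [hv]
  · field_simp

/-- Equality of the two norms makes the polar form of `v - w` and `v` equal to the norm of `v - w`,
so the multiple subtracted from `v` is exactly `v - w`. -/
theorem reflect_sub_apply {v w : Idx s t → ℝ} (h : stdForm s t v = stdForm s t w)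
    (hvw : stdForm s t (v - w) ≠ 0) : reflect (v - w) v = w := by
  have h1 : B (v - w) v = stdForm s t (v - w) := by
    have h2 := stdForm_sub_smul v w 1
    rw [one_smul] at h2
    rw [h2, QuadraticMap.polar_sub_left, QuadraticMap.polar_self, two_nsmul]
    linear_combination h
  rw [reflect_apply, h1, inv_mul_cancel₀ hvw, one_smul, sub_sub_cancel]

theorem reflect_add_apply {v w : Idx s t → ℝ} (h : stdForm s t v = stdForm s t w)
    (hvw : stdForm s t (v + w) ≠ 0) : reflect (v + w) v = -w := by
  rw [← sub_neg_eq_add] at hvw ⊢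
  exact reflect_sub_apply (by rw [h, QuadraticMap.map_neg]) hvw

theorem reflect_self_apply {v : Idx s t → ℝ} (hv : stdForm s t v ≠ 0) : reflect v v = -v := by
  rw [reflect_apply, QuadraticMap.polar_self, two_nsmul, ← two_mul, mul_left_comm,
    inv_mul_cancel₀ hv]
  module

/-- Conjugation by a vector is minus the reflection; the signs cancel for a product of two vectors.
-/
theorem ι_mul_ι_eq_refl {v : Idx s t → ℝ} (hv : stdForm s t v ≠ 0) (x : Idx s t → ℝ) :
    CliffordAlgebra.ι (stdForm s t) v * CliffordAlgebra.ι (stdForm s t) x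
      = -(CliffordAlgebra.ι (stdForm s t) (reflect v x) * CliffordAlgebra.ι (stdForm s t) v) := by
  have h1 := CliffordAlgebra.ι_mul_ι_add_swap (Q := stdForm s t) v x
  rw [reflect_apply, map_sub, map_smul, sub_mul, smul_mul_assoc, CliffordAlgebra.ι_sq_scalar,
    eq_neg_iff_add_eq_zero, ← add_sub_assoc, h1, Algebra.algebraMap_eq_smul_one,
    Algebra.algebraMap_eq_smul_one, smul_smul, mul_right_comm, inv_mul_cancel₀ hv, one_mul,
    sub_self]

/-! ### Unit vectors and their pairwise products -/

theorem continuous_stdForm (s t : ℕ) : Continuous (stdForm s t) := by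
  have h : (stdForm s t : (Idx s t → ℝ) → ℝ) = fun v => ∑ i, idxSign i * (v i * v i) :=
    funext stdForm_apply
  rw [h]
  fun_prop

/-- The multiple of the non-null vector `v` that is a unit vector. -/
def unitize (v : Idx s t → ℝ) : Idx s t → ℝ := (√|stdForm s t v|)⁻¹ • v

theorem stdForm_unitize (v : Idx s t → ℝ) :
    stdForm s t (unitize v) = |stdForm s t v|⁻¹ * stdForm s t v := by
  rw [unitize, QuadraticMap.map_smul, smul_eq_mul, ← mul_inv, Real.mul_self_sqrt (abs_nonneg _)]

theorem isUnitVector_unitize {v : Idx s t → ℝ} (hv : stdForm s t v ≠ 0) :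
    IsUnitVector s t (unitize v) := by
  rw [IsUnitVector, stdForm_unitize]
  rcases hv.lt_or_gt with h | h
  · right
    rw [abs_of_neg h]
    field_simp
  · left
    rw [abs_of_pos h, inv_mul_cancel₀ h.ne']

theorem reflect_unitize {v : Idx s t → ℝ} (hv : stdForm s t v ≠ 0) : reflect (unitize v) = reflect v :=
  reflect_smul (inv_ne_zero (Real.sqrt_ne_zero'.2 (abs_pos.2 hv))) v

theorem IsUnitVector.stdForm_mul_self {v : Idx s t → ℝ} (hv : IsUnitVector s t v) :
    stdForm s t v * stdForm s t v = 1 := by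
  rcases hv with h | h <;> rw [h] <;> norm_num

theorem IsUnitVector.stdForm_ne_zero {v : Idx s t → ℝ} (hv : IsUnitVector s t v) :
    stdForm s t v ≠ 0 := fun h => by
  have := hv.stdForm_mul_self
  rw [h] at this
  norm_num at this

theorem IsUnitVector.smul {v : Idx s t → ℝ} (hv : IsUnitVector s t v) {c : ℝ} (hc : c * c = 1) :
    IsUnitVector s t (c • v) := by
  rwa [IsUnitVector, QuadraticMap.map_smul, smul_eq_mul, hc, one_mul]

/-- The inverse of a unit vector is the vector scaled by its own norm `±1`. -/
theorem ι_mul_ι_mul_ι_mul_ι {v w : Idx s t → ℝ} (hv : IsUnitVector s t v)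
    (hw : IsUnitVector s t w) :
    (CliffordAlgebra.ι (stdForm s t) v * CliffordAlgebra.ι (stdForm s t) w) *
      (CliffordAlgebra.ι (stdForm s t) (stdForm s t w • w) *
        CliffordAlgebra.ι (stdForm s t) (stdForm s t v • v)) = 1 := by
  rw [map_smul, map_smul, smul_mul_smul_comm, mul_smul_comm, mul_assoc, ← mul_assoc _ _
    (CliffordAlgebra.ι (stdForm s t) v), CliffordAlgebra.ι_sq_scalar, Algebra.commutes,
    ← mul_assoc, CliffordAlgebra.ι_sq_scalar, ← map_mul (algebraMap ℝ (Cl s t)), Algebra.algebraMap_eq_smul_one, smul_smul]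
  convert one_smul ℝ _
  linear_combination hv.stdForm_mul_self * (stdForm s t w * stdForm s t w) + hw.stdForm_mul_self

namespace Spin

/-- The product of two unit vectors, as an element of `Spin(s,t)`. -/
def ofPair (v w : Idx s t → ℝ) (hv : IsUnitVector s t v) (hw : IsUnitVector s t w) : Spin s t :=
  ⟨⟨CliffordAlgebra.ι (stdForm s t) v * CliffordAlgebra.ι (stdForm s t) w,
    CliffordAlgebra.ι (stdForm s t) (stdForm s t w • w) *
        CliffordAlgebra.ι (stdForm s t) (stdForm s t v • v),
    ι_mul_ι_mul_ι_mul_ι hv hw, by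
      -- The same identity applied to the rescaled vectors: rescaling twice returns the original
      -- ones.
      have h := ι_mul_ι_mul_ι_mul_ι (hw.smul hw.stdForm_mul_self) (hv.smul hv.stdForm_mul_self)
      rw [QuadraticMap.map_smul, QuadraticMap.map_smul, smul_smul, smul_smul, smul_eq_mul,
        smul_eq_mul, hv.stdForm_mul_self, hw.stdForm_mul_self, one_mul, one_mul,
        hv.stdForm_mul_self, hw.stdForm_mul_self, one_smul, one_smul] at h
      exact h⟩,
    Subgroup.subset_closure (Or.inr ⟨v, w, hv, hw, rfl⟩)⟩

theorem toCl_ofPair {v w : Idx s t → ℝ} (hv : IsUnitVector s t v) (hw : IsUnitVector s t w) :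
    toCl (ofPair v w hv hw)
      = CliffordAlgebra.ι (stdForm s t) v * CliffordAlgebra.ι (stdForm s t) w := rfl

theorem conj_ofPair {v w : Idx s t → ℝ} (hv : IsUnitVector s t v) (hw : IsUnitVector s t w) :
    conj (ofPair v w hv hw) = reflect v ∘ₗ reflect w := by
  refine conj_eq fun x => ?_
  change CliffordAlgebra.ι (stdForm s t) v * CliffordAlgebra.ι (stdForm s t) w * _
    = _ * (CliffordAlgebra.ι (stdForm s t) v * CliffordAlgebra.ι (stdForm s t) w)
  rw [mul_assoc, ι_mul_ι_eq_refl hw.stdForm_ne_zero, mul_neg, ← mul_assoc,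
    ι_mul_ι_eq_refl hv.stdForm_ne_zero, neg_mul, neg_neg, mul_assoc]
  rfl

theorem exists_conj_eq_refl_comp_refl {v w : Idx s t → ℝ} (hv : stdForm s t v ≠ 0)
    (hw : stdForm s t w ≠ 0) : ∃ a : Spin s t, conj a = reflect v ∘ₗ reflect w :=
  ⟨ofPair _ _ (isUnitVector_unitize hv) (isUnitVector_unitize hw), by
    rw [conj_ofPair, reflect_unitize hv, reflect_unitize hw]⟩

/-! ## Surjectivity of `Spin(s,t) → SO(s,t)` -/

/-- Induction on the set of basis vectors not yet known to be fixed. To fix one more vector `e`,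
compose with the reflection in `A e - e`, or, if that vector is null, with those in `A e + e` and
then `e`. All these mirror vectors are orthogonal to the basis vectors already fixed. The two
alternatives record the parity of the number of reflections. -/
theorem exists_conj_or_refl_of_fixes (U : Finset (Idx s t)) :
    ∀ A : (Idx s t → ℝ) →ₗ[ℝ] (Idx s t → ℝ), (∀ x, stdForm s t (A x) = stdForm s t x) →
      (∀ i ∉ U, A (Pi.single i 1) = Pi.single i 1) →
      ∃ a : Spin s t, A = conj a ∨ ∃ w, stdForm s t w ≠ 0 ∧ A = reflect w ∘ₗ conj a := by
  -- Undoing one reflection exchanges the two alternatives, since two reflections together come from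
  -- an element of `Spin`.
  have hrefl : ∀ (A : (Idx s t → ℝ) →ₗ[ℝ] (Idx s t → ℝ)) (v : Idx s t → ℝ),
      stdForm s t v ≠ 0 →
      (∃ a : Spin s t, reflect v ∘ₗ A = conj a ∨ ∃ w, stdForm s t w ≠ 0 ∧
        reflect v ∘ₗ A = reflect w ∘ₗ conj a) →
      ∃ a : Spin s t, A = conj a ∨ ∃ w, stdForm s t w ≠ 0 ∧ A = reflect w ∘ₗ conj a := by
    rintro A v hv ⟨a, h⟩
    have hA : A = reflect v ∘ₗ (reflect v ∘ₗ A) := by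
      rw [← LinearMap.comp_assoc, reflect_comp_refl hv, LinearMap.id_comp]
    rcases h with h | ⟨w, hw, h⟩
    · exact ⟨a, Or.inr ⟨v, hv, by rw [hA, h]⟩⟩
    · obtain ⟨b, hb⟩ := exists_conj_eq_refl_comp_refl hv hw
      exact ⟨b * a, Or.inl (by rw [hA, h, conj_mul, hb, LinearMap.comp_assoc])⟩
  induction U using Finset.induction_on with
  | empty =>
    intro A _ hA
    refine ⟨1, Or.inl ?_⟩
    rw [conj_one]
    refine (Pi.basisFun ℝ (Idx s t)).ext fun i => ?_
    rw [Pi.basisFun_apply]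
    exact hA i (Finset.notMem_empty i)
  | insert k U hk ih =>
    intro A hA hfix
    set e : Idx s t → ℝ := Pi.single k 1 with he
    have hqe : stdForm s t e ≠ 0 := by rw [he, stdForm_single]; exact idxSign_ne_zero k
    have hpolar : ∀ x y, B (A x) (A y) = B x y := by
      intro x y
      simp only [QuadraticMap.polar, ← map_add, hA]
    have hort : ∀ i ∉ U, i ≠ k → B e (Pi.single i 1) = 0 ∧ B (A e) (Pi.single i 1) = 0 := by
      intro i hi hik
      have h1 : B e (Pi.single i 1) = 0 := by
        rw [polar_stdForm_single, he, Pi.single_eq_of_ne hik, mul_zero]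
      refine ⟨h1, ?_⟩
      have h2 := hpolar e (Pi.single i 1)
      rwa [hfix i (by simp [hi, hik]), h1] at h2
    -- The parallelogram law: `A e - e` and `A e + e` cannot both be null.
    have hsum : stdForm s t (A e - e) + stdForm s t (A e + e) = 4 * stdForm s t e := by
      have h1 := stdForm_sub_smul (A e) e 1
      have h2 := stdForm_sub_smul (A e) e (-1)
      rw [one_smul] at h1
      rw [neg_one_smul, sub_neg_eq_add] at h2
      rw [h1, h2, hA]
      ring
    by_cases hm : stdForm s t (A e - e) = 0
    · have hp : stdForm s t (A e + e) ≠ 0 := by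
        intro h
        rw [hm, h] at hsum
        apply hqe
        linarith
      refine hrefl _ _ hp (hrefl _ _ hqe (ih _ ?_ ?_))
      · intro x
        rw [LinearMap.comp_apply, LinearMap.comp_apply, stdForm_refl hqe, stdForm_refl hp, hA]
      · intro i hi
        rw [LinearMap.comp_apply, LinearMap.comp_apply]
        by_cases hik : i = k
        · rw [hik, ← he, reflect_add_apply (hA e) hp, map_neg, reflect_self_apply hqe, neg_neg]
        · obtain ⟨h1, h2⟩ := hort i hi hik
          rw [hfix i (by simp [hi, hik]), reflect_of_polar_eq_zero (v := A e + e),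
            reflect_of_polar_eq_zero h1]
          rw [QuadraticMap.polar_add_left, h1, h2, add_zero]
    · refine hrefl _ _ hm (ih _ ?_ ?_)
      · intro x
        rw [LinearMap.comp_apply, stdForm_refl hm, hA]
      · intro i hi
        rw [LinearMap.comp_apply]
        by_cases hik : i = k
        · rw [hik, ← he, reflect_sub_apply (hA e) hm]
        · obtain ⟨h1, h2⟩ := hort i hi hik
          rw [hfix i (by simp [hi, hik]), reflect_of_polar_eq_zero]
          rw [QuadraticMap.polar_sub_left, h1, h2, sub_zero]

theorem π_eq_of_conj {a : Spin s t} {A : SO s t}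
    (h : conj a = Matrix.toLin' (A : Matrix.SpecialLinearGroup (Idx s t) ℝ).1) : π s t a = A := by
  apply Subtype.ext
  apply Subtype.ext
  change LinearMap.toMatrix' (conj a) = _
  rw [h, LinearMap.toMatrix'_toLin']

theorem stdForm_toLin' (A : SO s t) (x : Idx s t → ℝ) :
    stdForm s t (Matrix.toLin' (A : Matrix.SpecialLinearGroup (Idx s t) ℝ).1 x)
      = stdForm s t x := A.2 x

/-- Determinant one rules out an odd number of reflections. -/
theorem π_surjective (s t : ℕ) : Function.Surjective (π s t) := by
  intro A
  have hdet : LinearMap.det (Matrix.toLin' (A : Matrix.SpecialLinearGroup (Idx s t) ℝ).1) = 1 := by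
    rw [LinearMap.det_toLin']
    exact A.1.2
  obtain ⟨a, ha⟩ := exists_conj_or_refl_of_fixes Finset.univ _ (stdForm_toLin' A) (by simp)
  rcases ha with ha | ⟨w, hw, ha⟩
  · exact ⟨a, π_eq_of_conj ha.symm⟩
  · rw [ha, LinearMap.det_comp, det_conj, det_refl hw] at hdet
    norm_num at hdet

/-! ## `Spin₀(s,t)` maps onto `SO₀(s,t)` -/

/-- The hypothesis says that the norm keeps the sign of that of `v` along the segment to `w`.
Normalising the moving vector then gives a path of products of two unit vectors, starting at `1`. -/
theorem exists_mem_spin₀_conj_eq {v w : Idx s t → ℝ}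
    (h : ∀ r ∈ Set.Icc (0 : ℝ) 1, 0 < stdForm s t v * stdForm s t (v + r • (w - v))) :
    ∃ a ∈ Spin₀ s t, conj a = reflect v ∘ₗ reflect w := by
  have hne : ∀ r ∈ Set.Icc (0 : ℝ) 1, stdForm s t (v + r • (w - v)) ≠ 0 := fun r hr h0 => by
    have := h r hr
    rw [h0, mul_zero] at this
    exact lt_irrefl _ this
  have hv : stdForm s t v ≠ 0 := fun h0 => by
    have := h 0 (by simp)
    rw [h0, zero_mul] at this
    exact lt_irrefl _ this
  have hw : stdForm s t w ≠ 0 := by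
    have := hne 1 (by simp)
    rwa [one_smul, add_sub_cancel] at this
  have hu := isUnitVector_unitize hv
  set ε := stdForm s t (unitize v) with hε
  -- The factor `ε = ±1` makes the path start at `ε` times the square of `unitize v`, which is `1`;
  -- it does not alter the reflection.
  let γ : Set.Icc (0 : ℝ) 1 → Spin s t := fun r =>
    ofPair (ε • unitize v) (unitize (v + r.1 • (w - v))) (hu.smul hu.stdForm_mul_self)
      (isUnitVector_unitize (hne r.1 r.2))
  have hγ : Continuous γ := by
    let : TopologicalSpace (Cl s t) := moduleTopology ℝ (Cl s t)
    have : IsModuleTopology ℝ (Cl s t) := ⟨rfl⟩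
    have : IsTopologicalRing (Cl s t) := IsModuleTopology.isTopologicalRing ℝ (Cl s t)
    rw [continuous_induced_rng]
    have hlin : Continuous (LinearMap.mulLeft ℝ (CliffordAlgebra.ι (stdForm s t) (ε • unitize v))
        ∘ₗ CliffordAlgebra.ι (stdForm s t)) := IsModuleTopology.continuous_of_linearMap _
    refine hlin.comp (?_ : Continuous fun r : Set.Icc (0 : ℝ) 1 => unitize (v + r.1 • (w - v)))
    have hq := continuous_stdForm s t
    have hc : Continuous fun r : Set.Icc (0 : ℝ) 1 => v + r.1 • (w - v) := by fun_prop
    change Continuous fun r : Set.Icc (0 : ℝ) 1 =>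
      (√|stdForm s t (v + r.1 • (w - v))|)⁻¹ • (v + r.1 • (w - v))
    have hs : Continuous fun r : Set.Icc (0 : ℝ) 1 => (√|stdForm s t (v + r.1 • (w - v))|)⁻¹ :=
      (hq.comp hc).abs.sqrt.inv₀ fun r => Real.sqrt_ne_zero'.2 (abs_pos.2 (hne r.1 r.2))
    exact hs.smul hc
  have h0 : γ ⟨0, by simp⟩ = 1 := by
    apply toCl_injective
    simp only [γ]
    rw [toCl_ofPair, zero_smul, add_zero, map_smul, smul_mul_assoc, CliffordAlgebra.ι_sq_scalar,
      ← hε, Algebra.algebraMap_eq_smul_one, smul_smul, hu.stdForm_mul_self, one_smul]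
    rfl
  refine ⟨γ ⟨1, by simp⟩, ?_, ?_⟩
  · exact (isPreconnected_range hγ).subset_connectedComponent ⟨_, h0⟩ ⟨_, rfl⟩
  · simp only [γ]
    rw [conj_ofPair, reflect_unitize (hne 1 (by simp)), reflect_smul hu.stdForm_ne_zero,
      reflect_unitize hv, one_smul, add_sub_cancel]

/-- A local form of the induction on reflections. Near the identity `A e + e` is close to `2 e`,
hence non-null, whereas `A e - e` is small and may be null; so the pair of reflections in `A e + e`
and `e` is always used. The isometry condition stays under the quantifier over nearby matrices, so
that the induction hypothesis can be evaluated at the corrected matrix. -/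
theorem eventually_exists_mem_spin₀_of_fixes (U : Finset (Idx s t)) :
    ∀ᶠ A : Matrix (Idx s t) (Idx s t) ℝ in 𝓝 1,
      (∀ x, stdForm s t (Matrix.toLin' A x) = stdForm s t x) →
      (∀ i ∉ U, Matrix.toLin' A (Pi.single i 1) = Pi.single i 1) →
      ∃ a ∈ Spin₀ s t, conj a = Matrix.toLin' A := by
  induction U using Finset.induction_on with
  | empty =>
    refine Filter.Eventually.of_forall fun A _ hA => ⟨1, one_mem _, ?_⟩
    rw [conj_one]
    refine (Pi.basisFun ℝ (Idx s t)).ext fun i => ?_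
    rw [Pi.basisFun_apply]
    exact (hA i (Finset.notMem_empty i)).symm
  | insert k U hk ih =>
    set e : Idx s t → ℝ := Pi.single k 1 with he
    have hqe : stdForm s t e * stdForm s t e = 1 := by
      rw [he, stdForm_single, idxSign_mul_self]
    have hqe0 : stdForm s t e ≠ 0 := fun h => by simp [h] at hqe
    have hq := continuous_stdForm s t
    have hAc : Continuous fun A : Matrix (Idx s t) (Idx s t) ℝ => Matrix.toLin' A e := by
      simp only [Matrix.toLin'_apply]
      fun_prop
    let R : (Idx s t → ℝ) → Matrix (Idx s t) (Idx s t) ℝ := fun v => LinearMap.toMatrix' (reflect v)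
    have hR : ∀ v, stdForm s t v ≠ 0 → ContinuousAt R v := by
      intro v hv
      refine continuousAt_pi.2 fun i => continuousAt_pi.2 fun j => ?_
      have : (fun v => R v i j) = fun v : Idx s t → ℝ => (Pi.single j 1 : Idx s t → ℝ) i -
          ((stdForm s t v)⁻¹ * (2 * idxSign j * v j)) * v i := by
        funext v
        simp only [R]
        rw [LinearMap.toMatrix'_apply, reflect_apply, polar_stdForm_single]
        rfl
      rw [this]
      exact continuousAt_const.sub (((hq.continuousAt.inv₀ hv).mul
        (continuousAt_const.mul (continuous_apply j).continuousAt)).mul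
        (continuous_apply i).continuousAt)
    -- The corrected matrix fixes `e` and depends continuously on `A` near `1`, with `f 1 = 1`.
    let f : Matrix (Idx s t) (Idx s t) ℝ → Matrix (Idx s t) (Idx s t) ℝ := fun A =>
      R e * (R (Matrix.toLin' A e + e) * A)
    have hf : ∀ A, Matrix.toLin' (f A)
        = reflect e ∘ₗ reflect (Matrix.toLin' A e + e) ∘ₗ Matrix.toLin' A := by
      intro A
      simp only [f, R, Matrix.toLin'_mul, Matrix.toLin'_toMatrix']
    have hee : reflect (e + e) = reflect e := by
      rw [← two_smul ℝ e, reflect_smul two_ne_zero]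
    have hf1 : f 1 = 1 := by
      apply Matrix.toLin'.injective
      rw [hf, Matrix.toLin'_one, LinearMap.id_apply, hee, LinearMap.comp_id, reflect_comp_refl hqe0]
    have hft : Filter.Tendsto f (𝓝 1) (𝓝 1) := by
      have : ContinuousAt f 1 := by
        refine continuousAt_const.mul (ContinuousAt.mul ?_ continuousAt_id)
        have h1 : ContinuousAt R (Matrix.toLin' (1 : Matrix (Idx s t) (Idx s t) ℝ) e + e) := by
          apply hR
          rw [Matrix.toLin'_one, LinearMap.id_apply, ← two_smul ℝ e, QuadraticMap.map_smul,
            smul_eq_mul]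
          exact mul_ne_zero (by norm_num) hqe0
        exact ContinuousAt.comp (f := fun A : Matrix (Idx s t) (Idx s t) ℝ =>
          Matrix.toLin' A e + e) h1 (hAc.add continuous_const).continuousAt
      have h2 := this.tendsto
      rwa [hf1] at h2
    have hpos : ∀ᶠ A : Matrix (Idx s t) (Idx s t) ℝ in 𝓝 1,
        0 < stdForm s t e * B e (Matrix.toLin' A e) := by
      have hc : Continuous fun A : Matrix (Idx s t) (Idx s t) ℝ =>
          stdForm s t e * B e (Matrix.toLin' A e) := by
        simp only [QuadraticMap.polar]
        fun_prop
      refine hc.continuousAt.eventually (lt_mem_nhds ?_)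
      change 0 < stdForm s t e * B e (Matrix.toLin' 1 e)
      rw [Matrix.toLin'_one, LinearMap.id_apply, QuadraticMap.polar_self, two_nsmul]
      linarith
    filter_upwards [hft.eventually ih, hpos] with A hAf hApos hA hfix
    have hpolar : ∀ x y, B (Matrix.toLin' A x) (Matrix.toLin' A y) = B x y := by
      intro x y
      simp only [QuadraticMap.polar, ← map_add, hA]
    obtain ⟨a, ha, haeq⟩ := exists_mem_spin₀_conj_eq (s := s) (t := t) (w := e)
      (v := Matrix.toLin' A e + e) (by
        -- The segment from `A e + e` to `e` consists of the vectors `e + c • A e` with `0 ≤ c ≤ 1`.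
        -- By this formula and `hApos` their norms all have the sign of the norm of `e`.
        have hcomp : ∀ c : ℝ, stdForm s t e * stdForm s t (e + c • Matrix.toLin' A e)
            = 1 + c * c + c * (stdForm s t e * B e (Matrix.toLin' A e)) := by
          intro c
          have h := stdForm_sub_smul e (Matrix.toLin' A e) (-c)
          rw [neg_smul, sub_neg_eq_add, hA, QuadraticMap.polar_comm] at h
          rw [h]
          linear_combination (1 + c * c) * hqe
        have hp : ∀ c : ℝ, 0 ≤ c →
            0 < stdForm s t e * stdForm s t (e + c • Matrix.toLin' A e) := by
          intro c hc
          rw [hcomp]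
          positivity
        intro r hr
        have h1 : Matrix.toLin' A e + e = e + (1 : ℝ) • Matrix.toLin' A e := by module
        have h2 : Matrix.toLin' A e + e + r • (e - (Matrix.toLin' A e + e))
            = e + (1 - r) • Matrix.toLin' A e := by module
        rw [h2, h1]
        have h3 := mul_pos (hp 1 zero_le_one) (hp (1 - r) (by linarith [hr.2]))
        have h4 : stdForm s t (e + (1 : ℝ) • Matrix.toLin' A e) *
            stdForm s t (e + (1 - r) • Matrix.toLin' A e)
            = stdForm s t e * stdForm s t (e + (1 : ℝ) • Matrix.toLin' A e) *
            (stdForm s t e * stdForm s t (e + (1 - r) • Matrix.toLin' A e)) := by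
          linear_combination (-(stdForm s t (e + (1 : ℝ) • Matrix.toLin' A e) *
            stdForm s t (e + (1 - r) • Matrix.toLin' A e))) * hqe
        rw [h4]
        exact h3)
    have hw : stdForm s t (Matrix.toLin' A e + e) ≠ 0 := by
      have h := stdForm_sub_smul (Matrix.toLin' A e) e (-1)
      rw [neg_one_smul, sub_neg_eq_add, hA] at h
      intro h0
      rw [h0] at h
      have : stdForm s t e * B e (Matrix.toLin' A e) = -2 := by
        linear_combination (-stdForm s t e) * h - 2 * hqe
      linarith
    obtain ⟨b, hb, hbeq⟩ := hAf (by
      intro x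
      rw [hf, LinearMap.comp_apply, LinearMap.comp_apply, stdForm_refl hqe0, stdForm_refl hw, hA])
      (by
      intro i hi
      rw [hf, LinearMap.comp_apply, LinearMap.comp_apply]
      by_cases hik : i = k
      · rw [hik, ← he, reflect_add_apply (hA e) hw, map_neg, reflect_self_apply hqe0, neg_neg]
      · have h1 : B e (Pi.single i 1) = 0 := by
          rw [polar_stdForm_single, he, Pi.single_eq_of_ne hik, mul_zero]
        have h2 := hpolar e (Pi.single i 1)
        rw [hfix i (by simp [hi, hik]), h1] at h2
        rw [hfix i (by simp [hi, hik]), reflect_of_polar_eq_zero (v := Matrix.toLin' A e + e),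
          reflect_of_polar_eq_zero h1]
        rw [QuadraticMap.polar_add_left, h1, h2, add_zero])
    -- Both reflections are involutions, so `A` is the reflection in `A e + e`, after that in `e`,
    -- after `f A`.
    refine ⟨a * b, mul_mem ha hb, ?_⟩
    rw [conj_mul, haeq, hbeq, hf]
    refine LinearMap.ext fun x => ?_
    simp only [LinearMap.comp_apply]
    rw [reflect_refl hqe0, reflect_refl hw]

theorem isOpen_map_spin₀ (s t : ℕ) : IsOpen (((Spin₀ s t).map (π s t) : Subgroup (SO s t)) :
    Set (SO s t)) := by
  refine Subgroup.isOpen_of_mem_nhds _ (g := 1) ?_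
  have hc : Continuous fun A : SO s t => (A : Matrix.SpecialLinearGroup (Idx s t) ℝ).1 :=
    continuous_subtype_val.comp continuous_subtype_val
  have h := hc.continuousAt (x := 1) |>.eventually
    (eventually_exists_mem_spin₀_of_fixes (s := s) (t := t) Finset.univ)
  filter_upwards [h] with A hA
  obtain ⟨a, ha, haeq⟩ := hA (stdForm_toLin' A) (by simp)
  exact ⟨a, ha, π_eq_of_conj haeq⟩

/-- The image of a connected set is connected, which gives one inclusion. For the other, an open
subgroup is also closed, so it contains the identity component. -/
theorem map_spin₀ (s t : ℕ) : (Spin₀ s t).map (π s t) = SO₀ s t := by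
  apply le_antisymm
  · rintro _ ⟨a, ha, rfl⟩
    have h := (continuous_π s t).image_connectedComponent_subset 1 ⟨a, ha, rfl⟩
    rwa [map_one] at h
  · have hopen := isOpen_map_spin₀ s t
    have hclosed := Subgroup.isClosed_of_isOpen _ hopen
    exact IsClopen.connectedComponent_subset ⟨hclosed, hopen⟩ (one_mem _)

end Spin

theorem isOpen_SO₀ (s t : ℕ) : IsOpen (SO₀ s t : Set (SO s t)) := by
  rw [← Spin.map_spin₀]
  exact Spin.isOpen_map_spin₀ s t

end Reflection

/-! ### The preimage of `SO₀(s,t)` in `Spin^G(s,t)` -/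

theorem SpinG.πHat_mk (s t : ℕ) {G : Type*} [Group G] (c : CentralZ2 G) (a : Spin s t) (g : G) :
    SpinG.πHat s t c (SpinG.mk s t c (a, g)) = Spin.π s t a := rfl

/-- If `π a` lies in `SO₀`, it equals `π b` for some `b` in `Spin₀`, so `a = ±b`. The sign can be
moved into the factor `G`, where there is no restriction; hence it does not matter whether `-1` lies
in `Spin₀`. -/
theorem SpinG.comap_SO₀ (s t : ℕ) {G : Type*} [Group G] (c : CentralZ2 G) :
    (SO₀ s t).comap (SpinG.πHat s t c) = SpinG₀ s t c := by
  ext k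
  rw [Subgroup.mem_comap]
  constructor
  · obtain ⟨⟨a, g⟩, rfl⟩ := QuotientGroup.mk'_surjective (diagZ2 s t c) k
    change Spin.π s t a ∈ SO₀ s t → SpinG.mk s t c (a, g) ∈ _
    intro h
    rw [← Spin.map_spin₀] at h
    obtain ⟨b, hb, hab⟩ := h
    have hconj : Spin.conj (b⁻¹ * a) = LinearMap.id := by
      have h1 : Spin.π s t (b⁻¹ * a) = 1 := by rw [map_mul, map_inv, hab, inv_mul_cancel]
      have h2 : LinearMap.toMatrix' (Spin.conj (b⁻¹ * a)) = 1 :=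
        congrArg (fun A : SO s t => (A : Matrix.SpecialLinearGroup (Idx s t) ℝ).1) h1
      exact LinearMap.toMatrix'.injective (by rw [h2, LinearMap.toMatrix'_id])
    rcases Spin.eq_one_or_eq_negOne_of_conj_eq_id hconj with h | h
    · rw [← eq_of_inv_mul_eq_one h]
      exact ⟨(b, g), ⟨hb, trivial⟩, rfl⟩
    · rw [inv_mul_eq_iff_eq_mul] at h
      -- Here `a = b * (-1)`, and `[-b, g] = [b, -g]`.
      refine ⟨(b, c.negOne * g), ⟨hb, trivial⟩, ?_⟩
      refine QuotientGroup.eq.2 (Or.inr ?_)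
      rw [h]
      refine Prod.ext (inv_mul_cancel_left b _) ?_
      change (c.negOne * g)⁻¹ * g = c.negOne
      rw [inv_mul_eq_iff_eq_mul, mul_assoc, Subgroup.mem_center_iff.1 c.mem_center g, ← mul_assoc,
        c.mul_self, one_mul]
  · rintro ⟨⟨a, g⟩, ⟨ha, _⟩, rfl⟩
    rw [SpinG.πHat_mk, ← Spin.map_spin₀]
    exact ⟨a, ha, rfl⟩

/-! ## Frames -/

theorem det_eq_one_or_neg_one_of_isometry {s t : ℕ} {A : (Idx s t → ℝ) →ₗ[ℝ] (Idx s t → ℝ)}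
    (hA : ∀ x, stdForm s t (A x) = stdForm s t x) :
    LinearMap.det A = 1 ∨ LinearMap.det A = -1 := by
  obtain ⟨a, rfl | ⟨w, hw, rfl⟩⟩ :=
    Spin.exists_conj_or_refl_of_fixes Finset.univ A hA (by simp)
  · exact Or.inl (Spin.det_conj a)
  · right
    rw [LinearMap.det_comp, Spin.det_conj, det_refl hw, mul_one]

namespace SOFrame

variable {s t : ℕ} {E : Type*} [NormedAddCommGroup E] [NormedSpace ℝ E]
  {M : Type*} [TopologicalSpace M] [ChartedSpace E M] [IsManifold 𝓘(ℝ, E) ∞ M]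
  {g : PseudoRiemannianMetric s t E M} {o : ManifoldOrientation s t E M}

theorem mk_eq_mk {x : M} {e e' : (Idx s t → ℝ) ≃ₗ[ℝ] TangentSpace 𝓘(ℝ, E) x}
    {he : ∀ v, g.val x (e v) (e v) = stdForm s t v}
    {he' : ∀ v, g.val x (e' v) (e' v) = stdForm s t v}
    {ho : ((Pi.basisFun ℝ (Idx s t)).map e).orientation = o.val x}
    {ho' : ((Pi.basisFun ℝ (Idx s t)).map e').orientation = o.val x} (h : ∀ v, e v = e' v) :
    (⟨x, e, he, ho⟩ : SOFrame g o) = ⟨x, e', he', ho'⟩ := by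
  obtain rfl : e = e' := LinearEquiv.ext h
  rfl

theorem act_mul (f : SOFrame g o) (A C : SO s t) : f.act (A * C) = (f.act A).act C := by
  refine mk_eq_mk fun v => ?_
  change f.toEquiv (Matrix.SpecialLinearGroup.toLin' (A * C : SO s t).1 v) = _
  rw [Subgroup.coe_mul, map_mul]
  rfl

theorem act_injective (f : SOFrame g o) : Function.Injective f.act := by
  intro A C h
  have he := (SOFrame.mk.inj h).2
  refine Subtype.ext (Matrix.SpecialLinearGroup.toLin'_injective (LinearEquiv.ext fun v => ?_))
  exact f.toEquiv.injective (LinearEquiv.congr_fun he v)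

/-- The comparison map of two frames is an isometry, so its determinant is `±1`; agreement of the
orientations makes it positive. -/
theorem exists_act_eq {f f' : SOFrame g o} (h : f.base = f'.base) : ∃ A, f' = f.act A := by
  obtain ⟨x, e, he, ho⟩ := f
  obtain ⟨x', e', he', ho'⟩ := f'
  obtain rfl : x = x' := h
  let L : (Idx s t → ℝ) ≃ₗ[ℝ] (Idx s t → ℝ) := e'.trans e.symm
  have hL : ∀ v, e (L v) = e' v := fun v => e.apply_symm_apply _
  have hiso : ∀ v, stdForm s t ((L : (Idx s t → ℝ) →ₗ[ℝ] (Idx s t → ℝ)) v) = stdForm s t v := by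
    intro v
    rw [← he, LinearEquiv.coe_coe, hL, he']
  have hpos : 0 < LinearMap.det (L : (Idx s t → ℝ) →ₗ[ℝ] (Idx s t → ℝ)) := by
    rw [← Module.Basis.orientation_comp_linearEquiv_eq_iff_det_pos (Pi.basisFun ℝ (Idx s t))]
    apply (Orientation.map (Idx s t) e).injective
    rw [← Module.Basis.orientation_map, ← Module.Basis.orientation_map, ho, ← ho']
    congr 1
    refine Module.Basis.eq_of_apply_eq fun i => ?_
    simp only [Module.Basis.map_apply]
    exact hL _
  have hdet : LinearMap.det (L : (Idx s t → ℝ) →ₗ[ℝ] (Idx s t → ℝ)) = 1 :=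
    (det_eq_one_or_neg_one_of_isometry hiso).resolve_right fun h => by
      rw [h] at hpos
      norm_num at hpos
  let A₁ : Matrix.SpecialLinearGroup (Idx s t) ℝ :=
    ⟨LinearMap.toMatrix' (L : (Idx s t → ℝ) →ₗ[ℝ] (Idx s t → ℝ)), by
      rw [LinearMap.det_toMatrix', hdet]⟩
  have hA₁ : ∀ v, Matrix.SpecialLinearGroup.toLin' A₁ v = L v := fun v =>
    LinearMap.congr_fun (Matrix.toLin'_toMatrix' (L : (Idx s t → ℝ) →ₗ[ℝ] (Idx s t → ℝ))) v
  refine ⟨⟨A₁, fun v => by rw [hA₁]; exact hiso v⟩, mk_eq_mk fun v => ?_⟩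
  rw [LinearEquiv.trans_apply, hA₁, hL]

/-- The transition function between two continuous families of frames is continuous. -/
theorem continuousAt_of_eq_act [FiniteDimensional ℝ E] {σ₁ σ₂ : M → SOFrame g o} {A : M → SO s t}
    {x : M} (hb : ∀ᶠ y in 𝓝 x, (σ₁ y).base = y) (hA : ∀ᶠ y in 𝓝 x, σ₂ y = (σ₁ y).act (A y))
    (h₁ : ∀ i, ContinuousAt (fun y => (σ₁ y).vec i) x)
    (h₂ : ∀ i, ContinuousAt (fun y => (σ₂ y).vec i) x) : ContinuousAt A x := by
  let τ := trivializationAt E (TangentSpace 𝓘(ℝ, E) (M := M)) x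
  have hx : x ∈ τ.baseSet := FiberBundle.mem_baseSet_trivializationAt' x
  -- A fixed identification of the model space with `ℝ^{s,t}`. Through it and the trivialization,
  -- each nearby frame becomes an invertible square matrix `N`.
  let L₀ : E ≃ₗ[ℝ] (Idx s t → ℝ) := (σ₁ x).toEquiv.symm
  let N : SOFrame g o → Matrix (Idx s t) (Idx s t) ℝ := fun f i j => L₀ (τ (f.vec j)).2 i
  let T : ∀ f : SOFrame g o, f.base ∈ τ.baseSet → ((Idx s t → ℝ) ≃ₗ[ℝ] (Idx s t → ℝ)) :=
    fun f hf => f.toEquiv.trans ((τ.linearEquivAt ℝ f.base hf).trans L₀)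
  have hT : ∀ f hf, N f = LinearMap.toMatrix' (T f hf : (Idx s t → ℝ) →ₗ[ℝ] (Idx s t → ℝ)) := by
    intro f hf
    ext i j
    rw [LinearMap.toMatrix'_apply]
    rfl
  have hdet : ∀ f : SOFrame g o, f.base ∈ τ.baseSet → (N f).det ≠ 0 := by
    intro f hf
    rw [hT f hf, LinearMap.det_toMatrix']
    exact (T f hf).isUnit_det'.ne_zero
  have hact : ∀ (f : SOFrame g o) (C : SO s t), f.base ∈ τ.baseSet →
      N (f.act C) = N f * (C : Matrix.SpecialLinearGroup (Idx s t) ℝ).1 := by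
    intro f C hf
    apply Matrix.toLin'.injective
    rw [hT f hf, hT (f.act C) hf, Matrix.toLin'_mul, Matrix.toLin'_toMatrix',
      Matrix.toLin'_toMatrix']
    rfl
  have hN : ∀ σ : M → SOFrame g o, (∀ i, ContinuousAt (fun y => (σ y).vec i) x) →
      (σ x).base = x → ContinuousAt (fun y => N (σ y)) x := by
    intro σ hσ hσx
    refine continuousAt_pi.2 fun i => continuousAt_pi.2 fun j => ?_
    have hτ : ContinuousAt τ ((σ x).vec j) := by
      refine τ.continuousAt ?_
      rw [τ.mem_source]
      change (σ x).base ∈ _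
      rwa [hσx]
    have hL : Continuous L₀ := L₀.toLinearMap.continuous_of_finiteDimensional
    have h := ContinuousAt.comp (f := fun y => (σ y).vec j) hτ (hσ j)
    exact (continuous_apply i).continuousAt.comp (hL.continuousAt.comp h.snd)
  have hbx : (σ₁ x).base = x := hb.self_of_nhds
  have hN₁ := hN σ₁ h₁ hbx
  have hN₂ := hN σ₂ h₂ (by rw [hA.self_of_nhds]; exact hbx)
  have hmem : ∀ᶠ y in 𝓝 x, y ∈ τ.baseSet := τ.open_baseSet.mem_nhds hx
  -- The transition matrix is `N(σ₁)⁻¹ N(σ₂)`, with the inverse written as adjugate over determinant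
  -- so that continuity is visible.
  have heq : (fun y => (A y : Matrix.SpecialLinearGroup (Idx s t) ℝ).1) =ᶠ[𝓝 x]
      fun y => (N (σ₁ y)).det⁻¹ • ((N (σ₁ y)).adjugate * N (σ₂ y)) := by
    filter_upwards [hb, hA, hmem] with y hby hAy hy
    rw [← hby] at hy
    rw [hAy, hact _ _ hy, ← mul_assoc, Matrix.adjugate_mul, smul_mul_assoc, one_mul, smul_smul,
      inv_mul_cancel₀ (hdet _ hy), one_smul]
  have hdx : (N (σ₁ x)).det ≠ 0 := hdet _ (by rwa [hbx])
  have hc : ContinuousAt (fun y => (A y : Matrix.SpecialLinearGroup (Idx s t) ℝ).1) x := by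
    refine ContinuousAt.congr ?_ heq.symm
    have hd : ContinuousAt (fun y => (N (σ₁ y)).det) x :=
      ContinuousAt.comp (g := Matrix.det) (Continuous.matrix_det continuous_id).continuousAt hN₁
    have ha : ContinuousAt (fun y => (N (σ₁ y)).adjugate) x :=
      ContinuousAt.comp (g := Matrix.adjugate)
        (Continuous.matrix_adjugate continuous_id).continuousAt hN₁
    exact (hd.inv₀ hdx).smul (ha.mul hN₂)
  have hind : Topology.IsInducing
      fun A : SO s t => (A : Matrix.SpecialLinearGroup (Idx s t) ℝ).1 :=
    Topology.IsInducing.subtypeVal.comp Topology.IsInducing.subtypeVal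
  exact hind.continuousAt_iff.2 hc

end SOFrame

/-! ## Reductions -/

theorem SmoothPrincipalBundle.contMDiff_act_const {E : Type*} [NormedAddCommGroup E]
    [NormedSpace ℝ E] {M : Type*} [TopologicalSpace M] [ChartedSpace E M]
    {EP : Type*} [NormedAddCommGroup EP] [NormedSpace ℝ EP]
    {P : Type*} [TopologicalSpace P] [ChartedSpace EP P]
    {K : Type*} [Group K] {d : DiffeologicalSpace K}
    (S : SmoothPrincipalBundle E M EP P K d) (k : K) :
    ContMDiff 𝓘(ℝ, EP) 𝓘(ℝ, EP) ∞ fun p => S.act p k :=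
  -- A single group element is a constant plot of dimension zero.
  (S.contMDiff_act 0 (fun _ => k) (d.constant_plots k)).comp
    ((contMDiff_const (c := (0 : EuclideanSpace ℝ (Fin 0)))).prodMk contMDiff_id)

namespace SpinGStructure

variable {s t : ℕ} {E : Type*} [NormedAddCommGroup E] [NormedSpace ℝ E]
  {M : Type*} [TopologicalSpace M] [ChartedSpace E M] [IsManifold 𝓘(ℝ, E) ∞ M]
  {g : PseudoRiemannianMetric s t E M} {o : ManifoldOrientation s t E M}
  {EG : Type*} [NormedAddCommGroup EG] [NormedSpace ℝ EG]
  {G : Type*} [Group G] [TopologicalSpace G] [ChartedSpace EG G] {c : CentralZ2 G}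
  {EP : Type*} [NormedAddCommGroup EP] [NormedSpace ℝ EP]
  {P : Type*} [TopologicalSpace P] [ChartedSpace EP P]

theorem smoothOn_frame_comp (S : SpinGStructure g o EG c EP P) {U : Set M} {σ : M → P}
    (hσ : ContMDiffOn 𝓘(ℝ, E) 𝓘(ℝ, EP) ∞ σ U) : SOFrame.SmoothOn U fun y => S.frame (σ y) :=
  fun i => (S.contMDiff_frame i).comp_contMDiffOn hσ

/-- The reduction is the preimage of `F₀`. The work lies in finding a smooth local section inside
it. -/
theorem reducesTo_of_timeOrientable [FiniteDimensional ℝ E] (S : SpinGStructure g o EG c EP P)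
    (h : TimeOrientable g o) : S.toSmoothPrincipalBundle.ReducesTo (SpinG₀ s t c) := by
  obtain ⟨F₀, hF⟩ := h
  refine ⟨S.frame ⁻¹' F₀, fun x => ?_⟩
  obtain ⟨U₁, hU₁, hx₁, σ₁, hσ₁, hb₁, hF₁⟩ := hF x
  obtain ⟨U₂, hU₂, hx₂, τ, -, hτ, hb₂, -⟩ := S.locally_trivial x
  -- Off the overlap the transition function gets the value `1`; only its values near `x` matter.
  have hex : ∀ y, ∃ A, y ∈ U₁ ∩ U₂ → S.frame (τ y) = (σ₁ y).act A := by
    intro y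
    by_cases hy : y ∈ U₁ ∩ U₂
    · obtain ⟨A, hA⟩ := SOFrame.exists_act_eq (f := σ₁ y) (f' := S.frame (τ y))
        (by rw [S.base_frame, hb₁ y hy.1, hb₂ y hy.2])
      exact ⟨A, fun _ => hA⟩
    · exact ⟨1, fun h => absurd h hy⟩
  choose A hA using hex
  have hU : U₁ ∩ U₂ ∈ 𝓝 x := Filter.inter_mem (hU₁.mem_nhds hx₁) (hU₂.mem_nhds hx₂)
  have hAc : ContinuousAt A x := by
    refine SOFrame.continuousAt_of_eq_act (σ₁ := σ₁) (σ₂ := fun y => S.frame (τ y)) ?_ ?_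
      (fun i => (hσ₁ i).continuousOn.continuousAt (hU₁.mem_nhds hx₁))
      (fun i => (S.smoothOn_frame_comp hτ i).continuousOn.continuousAt (hU₂.mem_nhds hx₂))
    · filter_upwards [hU] with y hy using hb₁ y hy.1
    · filter_upwards [hU] with y hy using hA y hy
  -- The expression is `1` at `x` and `SO₀` is open.
  have hV : ∀ᶠ y in 𝓝 x, A y * (A x)⁻¹ ∈ SO₀ s t := by
    refine (hAc.mul continuousAt_const).eventually ((isOpen_SO₀ s t).mem_nhds ?_)
    change A x * (A x)⁻¹ ∈ SO₀ s t
    rw [mul_inv_cancel]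
    exact one_mem _
  obtain ⟨W, hWsub, hW, hxW⟩ := mem_nhds_iff.1 (Filter.inter_mem hU hV)
  -- Translating `τ` by a lift of `(A x)⁻¹` puts its frames in `F₀` near `x`. The lift is constant,
  -- so smoothness is kept.
  obtain ⟨a, ha⟩ := Spin.π_surjective s t (A x)⁻¹
  let σ : M → P := fun y => S.act (τ y) (SpinG.mk s t c (a, 1))
  have hσ : ∀ y ∈ W, S.frame (σ y) = (σ₁ y).act (A y * (A x)⁻¹) := by
    intro y hy
    rw [S.frame_act, hA y (hWsub hy).1, SpinG.πHat_mk, ha, SOFrame.act_mul]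
  have hproj : ∀ y ∈ W, S.proj (σ y) = y := fun y hy => by
    rw [S.proj_act, hb₂ y (hWsub hy).1.2]
  refine ⟨W, hW, hxW, σ, (S.contMDiff_act_const _).comp_contMDiffOn
    (hτ.mono fun y hy => (hWsub hy).1.2), hproj, fun p hp => ?_⟩
  have hcoset : ∀ k, S.act (σ (S.proj p)) k = p →
      S.frame p = (σ₁ (S.proj p)).act
        (A (S.proj p) * (A x)⁻¹ * SpinG.πHat s t c k) := by
    intro k hk
    rw [SOFrame.act_mul, ← hσ _ hp, ← S.frame_act, hk]
  have hmem : A (S.proj p) * (A x)⁻¹ ∈ SO₀ s t := (hWsub hp).2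
  have hF₁' := hF₁ (S.frame p) (by rw [S.base_frame]; exact (hWsub hp).1.1)
  rw [S.base_frame] at hF₁'
  rw [Set.mem_preimage, hF₁']
  constructor
  · rintro ⟨C, hC, hfC⟩
    obtain ⟨k, hk, -⟩ := S.existsUnique_act (σ (S.proj p)) p (hproj _ hp)
    refine ⟨k, ?_, hk.symm⟩
    rw [hcoset k hk] at hfC
    rw [← SpinG.comap_SO₀, Subgroup.mem_comap]
    rw [← SOFrame.act_injective _ hfC] at hC
    exact (Subgroup.mul_mem_cancel_left _ hmem).1 hC
  · rintro ⟨k, hk, hpk⟩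
    rw [← SpinG.comap_SO₀, Subgroup.mem_comap] at hk
    exact ⟨_, mul_mem hmem hk, hcoset k hpk.symm⟩

/-- The image of `P₀` is saturated under `SO₀`, and a section adapted to `P₀` composed with `frame`
is adapted to the result, because `SpinG.πHat` maps `SpinG₀` into `SO₀`. -/
theorem timeOrientable_of_reducesTo (S : SpinGStructure g o EG c EP P)
    (h : S.toSmoothPrincipalBundle.ReducesTo (SpinG₀ s t c)) : TimeOrientable g o := by
  obtain ⟨P₀, hP⟩ := h
  refine ⟨{f | ∃ p ∈ P₀, ∃ C ∈ SO₀ s t, f = (S.frame p).act C}, fun x => ?_⟩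
  obtain ⟨U, hU, hx, σ, hσ, hb, hP₀⟩ := hP x
  refine ⟨U, hU, hx, fun y => S.frame (σ y), S.smoothOn_frame_comp hσ,
    fun y hy => by rw [S.base_frame, hb y hy], fun f hf => ?_⟩
  constructor
  · rintro ⟨p, hp, C, hC, rfl⟩
    change (S.frame p).base ∈ U at hf
    rw [S.base_frame] at hf
    obtain ⟨k, hk, hpk⟩ := (hP₀ p hf).1 hp
    rw [← SpinG.comap_SO₀, Subgroup.mem_comap] at hk
    refine ⟨SpinG.πHat s t c k * C, mul_mem hk hC, ?_⟩
    change _ = (S.frame (σ (S.frame p).base)).act _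
    rw [S.base_frame, SOFrame.act_mul, ← S.frame_act, ← hpk]
  · rintro ⟨C, hC, hfC⟩
    -- The adapted section itself takes values in `P₀`, as the translate by `1`.
    refine ⟨σ f.base, ?_, C, hC, hfC⟩
    have hproj := hb f.base hf
    refine (hP₀ _ (by rwa [hproj])).2 ⟨1, one_mem _, ?_⟩
    rw [S.act_one, hproj]

end SpinGStructure

end

theorem mainTheorem8 (s t : ℕ) (hs : 1 ≤ s) (ht : 1 ≤ t)
    {E : Type*} [NormedAddCommGroup E] [NormedSpace ℝ E] [FiniteDimensional ℝ E]
    {M : Type*} [TopologicalSpace M] [ChartedSpace E M] [IsManifold 𝓘(ℝ, E) ∞ M]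
    [T2Space M] [SecondCountableTopology M]
    (g : PseudoRiemannianMetric s t E M) (o : ManifoldOrientation s t E M)
    {EG : Type*} [NormedAddCommGroup EG] [NormedSpace ℝ EG] [FiniteDimensional ℝ EG]
    {G : Type*} [Group G] [TopologicalSpace G] [ChartedSpace EG G] [LieGroup 𝓘(ℝ, EG) ∞ G]
    (c : CentralZ2 G)
    {EP : Type*} [NormedAddCommGroup EP] [NormedSpace ℝ EP] [FiniteDimensional ℝ EP]
    {P : Type*} [TopologicalSpace P] [ChartedSpace EP P] [IsManifold 𝓘(ℝ, EP) ∞ P]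
    (S : SpinGStructure g o EG c EP P) :
    TimeOrientable g o ↔ S.toSmoothPrincipalBundle.ReducesTo (SpinG₀ s t c) :=
  ⟨S.reducesTo_of_timeOrientable, S.timeOrientable_of_reducesTo⟩
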